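/- Let $\gamma\in(1,2]$. There is exactly one continuous function $s_\gamma:(0,\infty)\to(0,\infty)$ such that $$\int_0^\infty e^{-\lambda x}s_\gamma(x)\,dx=\exp\bigl(-\gamma\lambda^{\frac{\gamma-1}{\gamma}}\bigr)\qquad\text{for all }\lambda\ge 0$$ (the continuous density of the spectrally positive $\frac{\gamma-1}{\gamma}$-stable distribution). Extended by $s_\gamma(0)=0$, the function $s_\gamma$ is $C^1$ on $[0,\infty)$, and $$\int_0^\infty |s_\gamma'(x)|\,dx<\infty,\qquad \int_0^\infty e^{-\lambda x}s_\gamma'(x)\,dx=\lambda\exp\bigl(-\gamma\lambda^{\frac{\gamma-1}{\gamma}}\bigr)\qquad\text{for all }\lambda\ge 0.$$ Moreover, there is exactly one real sequence $(S_n)_{n\ge 0}$ with $S_0=1$ such that, for every integer $N\ge 1$, as $x\to 0+$, $$\Bigl(2\pi\bigl(1-\tfrac1\gamma\bigr)\Bigr)^{\frac12}x^{\frac{\gamma+1}{2}}e^{1/x^{\gamma-1}}s_\gamma((\gamma-1)x)=1+\sum_{1\le n<N}S_n x^{n(\gamma-1)}+\mathcal O_{N,\gamma}\bigl(x^{N(\gamma-1)}\bigr).$$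 Define $(T_n)_{n\ge 0}$ by $T_0=1$ and $$T_{n+1}=S_{n+1}+\Bigl(n-\frac12-\frac1{\gamma-1}\Bigr)S_n\qquad\text{for all integers } n\ge 0.$$ Then, for every integer $N\ge 1$, as $x\to 0+$, $$\Bigl(2\pi\bigl(1-\tfrac1\gamma\bigr)\Bigr)^{\frac12}x^{\frac{3\gamma+1}{2}}e^{1/x^{\gamma-1}}s_\gamma'((\gamma-1)x)=1+\sum_{1\le n<N}T_n x^{n(\gamma-1)}+\mathcal O_{N,\gamma}\bigl(x^{N(\gamma-1)}\bigr).$$ Here the constants implied by $\mathcal O_{N,\gamma}$ may depend on $N$ and $\gamma$. -/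

import Mathlib

namespace StableLaw

/-- `IsStableDensity γ s` says that `s` is the continuous version of the density of the spectrally
positive `(γ - 1) / γ`-stable law, normalised so that its Laplace transform is
`exp (-γ * lam ^ ((γ - 1) / γ))`. A function on `(0, ∞)` is represented by its extension by `0`
to `ℝ`. Integrability of `x ↦ exp (-lam * x) * s x` on `(0, ∞)` need not be listed: the right-hand
side of `laplace` is nonzero, while the integral of a non-integrable function is `0`. -/
structure IsStableDensity (γ : ℝ) (s : ℝ → ℝ) : Prop where
  eq_zero : ∀ x, x ≤ 0 → s x = 0
  pos : ∀ x, 0 < x → 0 < s x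
  continuousOn : ContinuousOn s (Set.Ioi 0)
  laplace : ∀ lam : ℝ, 0 ≤ lam →
    ∫ x in Set.Ioi (0 : ℝ), Real.exp (-lam * x) * s x
      = Real.exp (-γ * lam ^ ((γ - 1) / γ))

/-- `HasExpansionAtZero γ p f a`: for every integer `N ≥ 1`, as `x → 0+`,
`(2π(1 - 1/γ))^(1/2) x^p exp (1 / x^(γ-1)) f ((γ-1) x)
  = 1 + ∑_{1 ≤ n < N} a n * x^(n(γ-1)) + O (x^(N(γ-1)))`. -/
def HasExpansionAtZero (γ p : ℝ) (f : ℝ → ℝ) (a : ℕ → ℝ) : Prop :=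
  ∀ N : ℕ, 1 ≤ N →
    Asymptotics.IsBigO (nhdsWithin (0 : ℝ) (Set.Ioi 0))
      (fun x : ℝ =>
        (2 * Real.pi * (1 - 1 / γ)) ^ (1 / 2 : ℝ) * x ^ p * Real.exp (1 / x ^ (γ - 1))
            * f ((γ - 1) * x)
          - (1 + ∑ n ∈ Finset.Ico 1 N, a n * x ^ ((n : ℝ) * (γ - 1))))
      (fun x : ℝ => x ^ ((N : ℝ) * (γ - 1)))

/-- The sequence `T` obtained from `S` by `T 0 = 1` and
`T (n + 1) = S (n + 1) + (n - 1/2 - 1/(γ - 1)) * S n`. -/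
noncomputable def derivCoeff (γ : ℝ) (S : ℕ → ℝ) : ℕ → ℝ
  | 0 => 1
  | n + 1 => S (n + 1) + ((n : ℝ) - 1 / 2 - 1 / (γ - 1)) * S n

end StableLaw

/-!
The density is constructed explicitly. Put `α = (γ - 1) / γ` (`idx γ`). Laplace inversion of
`exp (-γ * lam ^ α)` leads to the integral of `exp (x * z - γ * z ^ α) / z` (for the
distribution function) along a path around the negative real axis; after rescaling, the
exponent is `y * ((γ - 1) * z - γ * z ^ α)` with
`y = (x / (γ - 1)) ^ (-(γ - 1))`, whose saddle point is `z = 1`. On the steepest descent path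
through `1`, given in polar coordinates by `z = exp (logRad γ φ + φ * I)`, the function
`(γ - 1) * z - γ * z ^ α` is real, equal to `-phase γ φ`, and `phase γ` increases from `1` to `∞`
on `(0, π)`. This gives the distribution function
`stableCdf γ x = π⁻¹ * ∫ φ in (0, π), exp (-(y * phase γ φ))`, and two differentiations in `x` give
the density `stableDensity` and its derivative `stableDensityDeriv` in terms of the moments
`phaseLaplace γ j y = ∫ φ in (0, π), phase γ φ ^ j * exp (-(y * phase γ φ))`. Since
`phase γ ≥ 1`, these decay like `exp (-y / 2)` as `x → 0`, so that the density is `C¹` on the whole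
line.

**Laplace transform.** In the coordinate `w = log z` all integrands are entire, and comparing a
primitive along the path with its values on the line `Im w = π` deforms the path to the negative
real axis (`integral_exp_phase`). This expresses `stableCdf` as `1` minus a Laplace integral of
the boundary values of `exp (-γ * z ^ α)`. Cauchy's theorem in the slit plane represents
`exp (-γ * lam ^ α)` as the Stieltjes transform of the same boundary values (`exp_neg_rpow_eq`),
and Fubini's theorem identifies the two (`laplace_jump`). The Laplace transforms of the density and
of its derivative follow by integration by parts.

**Expansions.** In the variable `u = √(phase γ φ - 1)` the measure `dφ` has an asymptotic expansion
in even powers of `u` at `u = 0`, because `phase γ` is an even analytic germ with nonzero second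
derivative at `0`. Integrating term by term (`phase_moment_expansion`) expands the moments of
`phase γ - 1` in powers of `1 / y`, the coefficients of the `j`-th one being multiples of
`b k * Γ (k + j + 1 / 2)` with the same `b` for all `j`. Writing `phase` and `phase ^ 2` in powers
of `phase - 1` and using the functional equation of `Γ`, all coefficients are expressed by a single
sequence `A` with `A 0 = 1`: the density has `S (n + 1) = A (n + 1) + (n + 1 / 2) * A n`, and the
coefficients of the derivative turn out to be those of `derivCoeff γ S`
(`exists_expansion_stableDensity`).

**Uniqueness.** A continuous integrable function whose Laplace transform vanishes at all natural
numbers is zero, by polynomial approximation in the variable `exp (-x)`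
(`eqOn_zero_of_laplace_eq_zero`). The coefficients of an asymptotic expansion are determined one
after the other.
-/

namespace StableLaw

open Real Set Filter Topology MeasureTheory

/-! ### Even analytic germs -/

/-- An even function `ℝ → ℝ` that is real analytic at `0`. -/
structure EvenAnalytic (f : ℝ → ℝ) : Prop where
  analyticAt : AnalyticAt ℝ f 0
  even : ∀ x, f (-x) = f x

lemma analyticAt_dslope {f : ℝ → ℝ} (hf : AnalyticAt ℝ f 0) : AnalyticAt ℝ (dslope f 0) 0 := by
  obtain ⟨p, hp⟩ := hf
  exact ⟨_, hp.has_fpower_series_dslope_fslope⟩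

lemma dslope_zero_apply (f : ℝ → ℝ) {x : ℝ} (hx : x ≠ 0) : dslope f 0 x = (f x - f 0) / x := by
  rw [dslope_of_ne _ hx, slope_def_field, sub_zero]

lemma eq_add_mul_dslope (f : ℝ → ℝ) (x : ℝ) : f x = f 0 + x * dslope f 0 x := by
  have := sub_smul_dslope f 0 x
  simp only [sub_zero, smul_eq_mul] at this
  linarith

lemma deriv_zero_of_even {f : ℝ → ℝ} (hf : ∀ x, f (-x) = f x) : deriv f 0 = 0 := by
  have h := deriv_comp_neg f 0
  simp only [hf, neg_zero] at h
  linarith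

namespace EvenAnalytic

/-- An even analytic germ minus its value at `0` is divisible by `x ^ 2`, and the quotient is again
an even analytic germ. -/
lemma exists_eq_add_sq_mul {f : ℝ → ℝ} (hf : EvenAnalytic f) :
    ∃ g, EvenAnalytic g ∧ ∀ x, f x = f 0 + x ^ 2 * g x := by
  have hodd : ∀ x, dslope f 0 (-x) = - dslope f 0 x := by
    intro x
    rcases eq_or_ne x 0 with rfl | hx
    · simp [deriv_zero_of_even hf.even]
    · rw [dslope_zero_apply f hx, dslope_zero_apply f (neg_ne_zero.2 hx), hf.even, div_neg]
  have h0 : dslope f 0 0 = 0 := by simp [deriv_zero_of_even hf.even]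
  refine ⟨dslope (dslope f 0) 0, ⟨analyticAt_dslope (analyticAt_dslope hf.analyticAt), ?_⟩, ?_⟩
  · intro x
    rcases eq_or_ne x 0 with rfl | hx
    · simp
    · rw [dslope_zero_apply _ hx, dslope_zero_apply _ (neg_ne_zero.2 hx), hodd, h0, sub_zero,
        sub_zero, neg_div_neg_eq]
  · intro x
    have h1 := eq_add_mul_dslope f x
    have h2 := eq_add_mul_dslope (dslope f 0) x
    rw [h0, zero_add] at h2
    rw [h2] at h1
    linear_combination h1

lemma div {f g : ℝ → ℝ} (hf : EvenAnalytic f) (hg : EvenAnalytic g) (h0 : g 0 ≠ 0) :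
    EvenAnalytic (fun x => f x / g x) :=
  ⟨hf.analyticAt.fun_div hg.analyticAt h0, fun x => by simp [hf.even, hg.even]⟩

lemma sqrt {f : ℝ → ℝ} (hf : EvenAnalytic f) (h0 : 0 < f 0) :
    EvenAnalytic (fun x => √(f x)) := by
  refine ⟨?_, fun x => by simp [hf.even]⟩
  have h1 : AnalyticAt ℝ (fun x => Real.exp (Real.log (f x) / 2)) 0 :=
    ((hf.analyticAt.log h0).fun_div analyticAt_const two_ne_zero).rexp
  refine h1.congr ?_
  filter_upwards [hf.analyticAt.continuousAt.eventually_const_lt h0] with x hx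
  rw [← Real.log_sqrt hx.le, Real.exp_log (Real.sqrt_pos.2 hx)]

end EvenAnalytic

lemma evenAnalytic_sinc : EvenAnalytic sinc := by
  refine ⟨?_, sinc_neg⟩
  rw [sinc_eq_dslope]
  exact analyticAt_dslope analyticAt_sin

/-! ### The steepest descent path and its phase -/

/-- The index `(γ - 1) / γ` of the stable law. -/
noncomputable def idx (γ : ℝ) : ℝ := (γ - 1) / γ

lemma idx_pos {γ : ℝ} (h1 : 1 < γ) : 0 < idx γ := div_pos (by linarith) (by linarith)

lemma idx_le_half {γ : ℝ} (h1 : 1 < γ) (h2 : γ ≤ 2) : idx γ ≤ 1 / 2 := by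
  unfold idx
  rw [div_le_div_iff₀ (by linarith) two_pos]
  linarith

lemma gamma_mul_idx {γ : ℝ} (h1 : 1 < γ) : γ * idx γ = γ - 1 := by
  unfold idx
  field_simp

lemma gamma_mul_one_sub_idx {γ : ℝ} (h1 : 1 < γ) : γ * (1 - idx γ) = 1 := by
  linarith [gamma_mul_idx h1]

/-- The logarithm of the modulus of the point of argument `φ` on the steepest descent path, through
its saddle point `1`, of `z ↦ (γ - 1) * z - γ * z ^ idx γ`. Writing it with `sinc` gives the right
value at `φ = 0`. -/
noncomputable def logRad (γ φ : ℝ) : ℝ := γ * (log (sinc (idx γ * φ)) - log (sinc φ))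

/-- Minus the (real) value of `z ↦ (γ - 1) * z - γ * z ^ idx γ` at the point of argument `φ` of its
steepest descent path through `1`. -/
noncomputable def phase (γ φ : ℝ) : ℝ :=
  γ * exp (idx γ * logRad γ φ) * cos (idx γ * φ) - (γ - 1) * exp (logRad γ φ) * cos φ

/-- The derivative of `phase γ` at `φ ∈ (0, π)`, divided by `φ`. -/
noncomputable def phaseSlope (γ φ : ℝ) : ℝ :=
  idx γ * exp (idx γ * logRad γ φ) * sinc (idx γ * φ) * (1 + deriv (logRad γ) φ ^ 2)

lemma logRad_zero (γ : ℝ) : logRad γ 0 = 0 := by simp [logRad]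

lemma phase_zero (γ : ℝ) : phase γ 0 = 1 := by simp [phase, logRad_zero]

lemma sinc_pos_of_mem {x : ℝ} (h0 : 0 < x) (h1 : x < π) : 0 < sinc x := by
  rw [sinc_of_ne_zero h0.ne']
  exact div_pos (sin_pos_of_pos_of_lt_pi h0 h1) h0

lemma evenAnalytic_logRad (γ : ℝ) : EvenAnalytic (logRad γ) := by
  refine ⟨?_, fun x => by simp [logRad, mul_neg, sinc_neg]⟩
  have h1 : AnalyticAt ℝ (fun φ => sinc (idx γ * φ)) 0 := by
    refine AnalyticAt.fun_comp (g := sinc) ?_ (analyticAt_const.mul analyticAt_id)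
    simpa using evenAnalytic_sinc.analyticAt
  refine analyticAt_const.mul ((h1.log ?_).sub (evenAnalytic_sinc.analyticAt.log ?_)) <;> simp

lemma evenAnalytic_phase (γ : ℝ) : EvenAnalytic (phase γ) := by
  refine ⟨?_, fun x => by simp [phase, (evenAnalytic_logRad γ).even, mul_neg]⟩
  have hl := (evenAnalytic_logRad γ).analyticAt
  have hc : AnalyticAt ℝ (fun φ => cos (idx γ * φ)) 0 :=
    analyticAt_cos.fun_comp (analyticAt_const.mul analyticAt_id)
  exact ((analyticAt_const.mul (analyticAt_const.mul hl).rexp).mul hc).sub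
    ((analyticAt_const.mul hl.rexp).mul analyticAt_cos)

lemma evenAnalytic_phaseSlope (γ : ℝ) : EvenAnalytic (phaseSlope γ) := by
  have hl := evenAnalytic_logRad γ
  have hd : ∀ x, deriv (logRad γ) (-x) = - deriv (logRad γ) x := by
    intro x
    have h := deriv_comp_neg (logRad γ) x
    simp only [hl.even] at h
    rw [h, neg_neg]
  refine ⟨?_, fun x => by simp [phaseSlope, hl.even, mul_neg, sinc_neg, hd]⟩
  have h1 : AnalyticAt ℝ (fun φ => sinc (idx γ * φ)) 0 := by
    refine AnalyticAt.fun_comp (g := sinc) ?_ (analyticAt_const.mul analyticAt_id)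
    simpa using evenAnalytic_sinc.analyticAt
  exact ((analyticAt_const.mul (analyticAt_const.mul hl.analyticAt).rexp).mul h1).mul
    (analyticAt_const.add (hl.analyticAt.deriv.pow 2))

lemma phaseSlope_zero (γ : ℝ) : phaseSlope γ 0 = idx γ := by
  simp [phaseSlope, logRad_zero, deriv_zero_of_even (evenAnalytic_logRad γ).even]

section Path

variable {γ φ : ℝ}

lemma idx_mul_mem (h1 : 1 < γ) (h2 : γ ≤ 2) (h0 : 0 < φ) (hπ : φ < π) :
    0 < idx γ * φ ∧ idx γ * φ < π / 2 := by
  have := idx_pos h1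
  have := idx_le_half h1 h2
  constructor
  · positivity
  · nlinarith

lemma sin_idx_pos (h1 : 1 < γ) (h2 : γ ≤ 2) (h0 : 0 < φ) (hπ : φ < π) :
    0 < sin (idx γ * φ) := by
  obtain ⟨ha, hb⟩ := idx_mul_mem h1 h2 h0 hπ
  exact sin_pos_of_pos_of_lt_pi ha (by linarith [pi_pos])

lemma logRad_eq (h1 : 1 < γ) (h2 : γ ≤ 2) (h0 : 0 < φ) (hπ : φ < π) :
    logRad γ φ = γ * (log (sin (idx γ * φ)) - log (sin φ) - log (idx γ)) := by
  have ha := idx_pos h1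
  obtain ⟨hb, hc⟩ := idx_mul_mem h1 h2 h0 hπ
  have hs := sin_idx_pos h1 h2 h0 hπ
  have hs' := sin_pos_of_pos_of_lt_pi h0 hπ
  rw [logRad, sinc_of_ne_zero hb.ne', sinc_of_ne_zero h0.ne', log_div hs.ne' hb.ne',
    log_div hs'.ne' h0.ne', log_mul ha.ne' h0.ne']
  ring

/-- The path is the curve on which `(γ - 1) * z - γ * z ^ idx γ` is real. -/
lemma exp_logRad_mul_sin (h1 : 1 < γ) (h2 : γ ≤ 2) (h0 : 0 < φ) (hπ : φ < π) :
    idx γ * (exp (logRad γ φ) * sin φ) = exp (idx γ * logRad γ φ) * sin (idx γ * φ) := by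
  have ha := idx_pos h1
  have hs := sin_idx_pos h1 h2 h0 hπ
  have hs' := sin_pos_of_pos_of_lt_pi h0 hπ
  have key : logRad γ φ = idx γ * logRad γ φ +
      (log (sin (idx γ * φ)) - log (sin φ) - log (idx γ)) := by
    have h := logRad_eq h1 h2 h0 hπ
    have hg := gamma_mul_one_sub_idx h1
    linear_combination (1 - idx γ) * h + (log (sin (idx γ * φ)) - log (sin φ) - log (idx γ)) * hg
  conv_lhs => rw [key]
  rw [exp_add, exp_sub, exp_sub, exp_log hs, exp_log hs', exp_log ha]
  field_simp

lemma hasDerivAt_logRad (h1 : 1 < γ) (h2 : γ ≤ 2) (h0 : 0 < φ) (hπ : φ < π) :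
    HasDerivAt (logRad γ)
      (γ * (idx γ * cos (idx γ * φ) / sin (idx γ * φ) - cos φ / sin φ)) φ := by
  have hs := sin_idx_pos h1 h2 h0 hπ
  have hs' := sin_pos_of_pos_of_lt_pi h0 hπ
  have hid : HasDerivAt (fun φ : ℝ => idx γ * φ) (idx γ) φ := by
    simpa using (hasDerivAt_id φ).const_mul (idx γ)
  have e1 := (hid.sin).log hs.ne'
  have e2 := (hasDerivAt_sin φ).log hs'.ne'
  have e3 := ((e1.sub e2).sub_const (log (idx γ))).const_mul γ
  refine (e3.congr_of_eventuallyEq ?_).congr_deriv (by ring)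
  filter_upwards [Ioo_mem_nhds h0 hπ] with x hx
  exact logRad_eq h1 h2 hx.1 hx.2

/-- The derivative of `phase γ` in manifestly positive form; the relation `exp_logRad_mul_sin`
between modulus and argument on the path is what makes it a sum of squares. -/
lemma hasDerivAt_phase (h1 : 1 < γ) (h2 : γ ≤ 2) (h0 : 0 < φ) (hπ : φ < π) :
    HasDerivAt (phase γ) (φ * phaseSlope γ φ) φ := by
  have hs := sin_idx_pos h1 h2 h0 hπ
  have hs' := sin_pos_of_pos_of_lt_pi h0 hπ
  have ha := idx_pos h1
  obtain ⟨hb, -⟩ := idx_mul_mem h1 h2 h0 hπ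
  have hρ := hasDerivAt_logRad h1 h2 h0 hπ
  have hid : HasDerivAt (fun φ : ℝ => idx γ * φ) (idx γ) φ := by
    simpa using (hasDerivAt_id φ).const_mul (idx γ)
  have e1 := ((hρ.const_mul (idx γ)).exp.const_mul γ).mul hid.cos
  have e2 := (hρ.exp.const_mul (γ - 1)).mul (hasDerivAt_cos φ)
  have hd := hρ.deriv
  refine (e1.sub e2).congr_deriv ?_
  rw [phaseSlope, hd, sinc_of_ne_zero hb.ne']
  have hp := exp_logRad_mul_sin h1 h2 h0 hπ
  have hg := gamma_mul_idx h1
  have hr : exp (logRad γ φ) = exp (idx γ * logRad γ φ) * sin (idx γ * φ) / (idx γ * sin φ) := by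
    rw [← hp]; field_simp
  rw [hr, ← hg]
  have hγ : γ = 1 / (1 - idx γ) := by
    rw [eq_div_iff (by linarith [idx_le_half h1 h2])]; exact gamma_mul_one_sub_idx h1
  have hne : 1 - idx γ ≠ 0 := by linarith [idx_le_half h1 h2]
  generalize idx γ = a at *
  subst hγ
  generalize exp (a * logRad _ φ) = r
  generalize sin φ = s at *
  generalize cos φ = c at *
  generalize sin (a * φ) = s' at *
  generalize cos (a * φ) = c' at *
  field_simp
  ring

lemma phaseSlope_pos (h1 : 1 < γ) (h2 : γ ≤ 2) (h0 : 0 < φ) (hπ : φ < π) :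
    0 < phaseSlope γ φ := by
  obtain ⟨hb, hc⟩ := idx_mul_mem h1 h2 h0 hπ
  have := idx_pos h1
  have := sinc_pos_of_mem hb (by linarith [pi_pos])
  unfold phaseSlope
  positivity

lemma continuousOn_phase (h1 : 1 < γ) (h2 : γ ≤ 2) : ContinuousOn (phase γ) (Ico 0 π) := by
  rintro x ⟨hx0, hxπ⟩
  rcases hx0.eq_or_lt with rfl | hx0
  · exact (evenAnalytic_phase γ).analyticAt.continuousAt.continuousWithinAt
  · exact (hasDerivAt_phase h1 h2 hx0 hxπ).continuousAt.continuousWithinAt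

lemma strictMonoOn_phase (h1 : 1 < γ) (h2 : γ ≤ 2) : StrictMonoOn (phase γ) (Ico 0 π) := by
  refine strictMonoOn_of_deriv_pos (convex_Ico 0 π) (continuousOn_phase h1 h2) ?_
  rw [interior_Ico]
  rintro x ⟨hx0, hxπ⟩
  rw [(hasDerivAt_phase h1 h2 hx0 hxπ).deriv]
  exact mul_pos hx0 (phaseSlope_pos h1 h2 hx0 hxπ)

lemma one_lt_phase (h1 : 1 < γ) (h2 : γ ≤ 2) (h0 : 0 < φ) (hπ : φ < π) : 1 < phase γ φ := by
  rw [← phase_zero γ]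
  exact strictMonoOn_phase h1 h2 ⟨le_rfl, pi_pos⟩ ⟨h0.le, hπ⟩ h0

lemma tendsto_logRad (h1 : 1 < γ) (h2 : γ ≤ 2) : Tendsto (logRad γ) (𝓝[<] π) atTop := by
  have hs : Tendsto sin (𝓝[<] π) (𝓝[>] 0) := by
    refine tendsto_nhdsWithin_iff.2 ⟨?_, ?_⟩
    · simpa using (continuous_sin.tendsto π).mono_left nhdsWithin_le_nhds
    · filter_upwards [Ioo_mem_nhdsLT pi_pos] with x hx
      exact sin_pos_of_pos_of_lt_pi hx.1 hx.2
  have hlog := tendsto_neg_atBot_atTop.comp (tendsto_log_nhdsGT_zero.comp hs)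
  have hpos : 0 < sin (idx γ * π) := by
    have := idx_pos h1
    have := idx_le_half h1 h2
    exact sin_pos_of_pos_of_lt_pi (by positivity) (by nlinarith [pi_pos])
  have h3 : Tendsto (fun φ => log (sin (idx γ * φ)) - log (idx γ)) (𝓝[<] π)
      (𝓝 (log (sin (idx γ * π)) - log (idx γ))) := by
    refine Tendsto.mono_left ?_ nhdsWithin_le_nhds
    refine ((continuousAt_log hpos.ne').tendsto.comp ?_).sub_const _
    exact Continuous.tendsto (f := fun φ => sin (idx γ * φ)) (by fun_prop) π
  have h4 := (h3.add_atTop hlog).const_mul_atTop (by linarith : 0 < γ)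
  refine h4.congr' ?_
  filter_upwards [Ioo_mem_nhdsLT pi_pos] with x hx
  rw [logRad_eq h1 h2 hx.1 hx.2]
  simp only [Function.comp_apply]
  ring

lemma tendsto_phase (h1 : 1 < γ) (h2 : γ ≤ 2) : Tendsto (phase γ) (𝓝[<] π) atTop := by
  have hcos : Tendsto (fun φ => - cos φ) (𝓝[<] π) (𝓝 1) := by
    have : Tendsto (fun φ => - cos φ) (𝓝 π) (𝓝 (- cos π)) :=
      Continuous.tendsto (f := fun φ => - cos φ) (by fun_prop) π
    rw [cos_pi, neg_neg] at this
    exact this.mono_left nhdsWithin_le_nhds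
  have h3 := ((tendsto_exp_atTop.comp (tendsto_logRad h1 h2)).const_mul_atTop
    (sub_pos.2 h1)).atTop_mul_pos one_pos hcos
  refine tendsto_atTop_mono' _ ?_ h3
  filter_upwards [Ioo_mem_nhdsLT pi_pos] with x hx
  obtain ⟨hb, hc⟩ := idx_mul_mem h1 h2 hx.1 hx.2
  have : 0 ≤ cos (idx γ * x) := cos_nonneg_of_mem_Icc ⟨by linarith, by linarith⟩
  have : 0 ≤ γ * exp (idx γ * logRad γ x) * cos (idx γ * x) := by positivity
  simp only [phase, Function.comp_apply]
  linarith

lemma image_phase (h1 : 1 < γ) (h2 : γ ≤ 2) :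
    (fun φ => phase γ φ - 1) '' Ioo 0 π = Ioi 0 := by
  apply Subset.antisymm
  · rintro _ ⟨x, hx, rfl⟩
    exact sub_pos.2 (one_lt_phase h1 h2 hx.1 hx.2)
  · intro t ht
    have hev : ∀ᶠ x in 𝓝[<] π, t + 1 < phase γ x ∧ x ∈ Ioo 0 π :=
      ((tendsto_phase h1 h2).eventually_gt_atTop (t + 1)).and (Ioo_mem_nhdsLT pi_pos)
    obtain ⟨x, hx, hxI⟩ := hev.exists
    have := intermediate_value_Ioo hxI.1.le
      ((continuousOn_phase h1 h2).mono (Icc_subset_Ico_right hxI.2))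
    obtain ⟨z, hz, hz'⟩ := this ⟨by rw [phase_zero]; linarith [mem_Ioi.1 ht], hx⟩
    exact ⟨z, ⟨hz.1, hz.2.trans hxI.2⟩, by simp [hz']⟩

lemma measurable_phase (γ : ℝ) : Measurable (phase γ) := by
  have hs : Measurable sinc := continuous_sinc.measurable
  unfold phase logRad
  fun_prop

end Path

/-! ### Watson's lemma for the phase -/

/-- Expansion of an even analytic germ in powers of the germ `x ^ 2 * B x`, with an even analytic
remainder. -/
lemma EvenAnalytic.exists_expansion {f B : ℝ → ℝ} (hf : EvenAnalytic f) (hB : EvenAnalytic B)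
    (hB0 : B 0 ≠ 0) :
    ∃ b : ℕ → ℝ, b 0 = f 0 ∧ ∀ N : ℕ, ∃ g, EvenAnalytic g ∧ ∀ᶠ x in 𝓝 (0 : ℝ),
      f x = ∑ k ∈ Finset.range N, b k * (x ^ 2 * B x) ^ k + (x ^ 2 * B x) ^ N * g x := by
  have hBne : ∀ᶠ x in 𝓝 (0 : ℝ), B x ≠ 0 := hB.analyticAt.continuousAt.eventually_ne hB0
  have step : ∀ h : {h : ℝ → ℝ // EvenAnalytic h}, ∃ g : {h : ℝ → ℝ // EvenAnalytic h},
      ∀ᶠ x in 𝓝 (0 : ℝ), h.1 x = h.1 0 + x ^ 2 * B x * g.1 x := by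
    rintro ⟨h, hh⟩
    obtain ⟨g, hg, hfg⟩ := hh.exists_eq_add_sq_mul
    refine ⟨⟨_, hg.div hB hB0⟩, ?_⟩
    filter_upwards [hBne] with x hx
    rw [hfg x]
    field_simp
  choose next hnext using step
  let F : ℕ → {h : ℝ → ℝ // EvenAnalytic h} := fun n => next^[n] ⟨f, hf⟩
  refine ⟨fun n => (F n).1 0, rfl, fun N => ⟨(F N).1, (F N).2, ?_⟩⟩
  induction N with
  | zero => simp [F]
  | succ N ih =>
    have hF : F (N + 1) = next (F N) := Function.iterate_succ_apply' _ _ _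
    filter_upwards [ih, hnext (F N)] with x hx hx'
    rw [hx, Finset.sum_range_succ, hF, pow_succ]
    linear_combination (x ^ 2 * B x) ^ N * hx'

lemma pow_mul_exp_neg_le (m : ℕ) {t y : ℝ} (ht : 0 ≤ t) (hy : 0 < y) :
    t ^ m * exp (-(y * t)) ≤ m.factorial * y⁻¹ ^ m := by
  have h := pow_div_factorial_le_exp (y * t) (by positivity) m
  rw [exp_neg, inv_pow, ← div_eq_mul_inv, ← div_eq_mul_inv,
    div_le_div_iff₀ (exp_pos _) (by positivity)]
  rw [div_le_iff₀ (by positivity), mul_pow] at h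
  linarith

/-- The derivative of `√(phase γ - 1)` on `(0, π)`. -/
noncomputable def rootDeriv (γ φ : ℝ) : ℝ := φ * phaseSlope γ φ / (2 * √(phase γ φ - 1))

lemma rootDeriv_pos {γ φ : ℝ} (h1 : 1 < γ) (h2 : γ ≤ 2) (h0 : 0 < φ) (hπ : φ < π) :
    0 < rootDeriv γ φ := by
  have := phaseSlope_pos h1 h2 h0 hπ
  have := one_lt_phase h1 h2 h0 hπ
  have : 0 < √(phase γ φ - 1) := Real.sqrt_pos.2 (by linarith)
  unfold rootDeriv
  positivity

/-- Near `0`, `phase γ φ = 1 + idx γ / 2 * φ ^ 2 + O (φ ^ 4)`, in factored form. -/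
lemma exists_phase_eq {γ : ℝ} (h1 : 1 < γ) (h2 : γ ≤ 2) :
    ∃ B, EvenAnalytic B ∧ B 0 = idx γ / 2 ∧ ∀ x, phase γ x - 1 = x ^ 2 * B x := by
  obtain ⟨B, hB, hAB⟩ := (evenAnalytic_phase γ).exists_eq_add_sq_mul
  simp only [phase_zero] at hAB
  refine ⟨B, hB, ?_, fun x => by rw [hAB x]; ring⟩
  -- comparing `deriv (phase γ) x = x * phaseSlope γ x` with the derivative of `1 + x ^ 2 * B x`
  have hlim : Tendsto (fun x => 2 * B x + x * deriv B x) (𝓝[>] 0) (𝓝 (2 * B 0)) := by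
    have hc : ContinuousAt (fun x => 2 * B x + x * deriv B x) 0 :=
      (continuousAt_const.mul hB.analyticAt.continuousAt).add
        (continuousAt_id.mul hB.analyticAt.deriv.continuousAt)
    simpa [ContinuousAt] using hc.tendsto.mono_left nhdsWithin_le_nhds
  have hlim' : Tendsto (phaseSlope γ) (𝓝[>] 0) (𝓝 (idx γ)) := by
    have := (evenAnalytic_phaseSlope γ).analyticAt.continuousAt.tendsto
    rw [phaseSlope_zero] at this
    exact this.mono_left nhdsWithin_le_nhds
  have heq : (fun x => 2 * B x + x * deriv B x) =ᶠ[𝓝[>] 0] phaseSlope γ := by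
    have hd : ∀ᶠ x in 𝓝[>] (0 : ℝ), DifferentiableAt ℝ B x :=
      nhdsWithin_le_nhds (hB.analyticAt.eventually_analyticAt.mono fun x hx => hx.differentiableAt)
    filter_upwards [hd, Ioo_mem_nhdsGT pi_pos] with x hx hxI
    have e1 : HasDerivAt (phase γ) (2 * x * B x + x ^ 2 * deriv B x) x := by
      have : phase γ = fun x => 1 + x ^ 2 * B x := funext hAB
      rw [this]
      refine (((hasDerivAt_pow 2 x).mul hx.hasDerivAt).const_add 1).congr_deriv ?_
      simp
    have e2 := e1.unique (hasDerivAt_phase h1 h2 hxI.1 hxI.2)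
    have hx0 : x ≠ 0 := hxI.1.ne'
    apply mul_left_cancel₀ hx0
    linear_combination e2
  have := tendsto_nhds_unique (hlim.congr' heq) hlim'
  linarith

/-- In the variable `u = √(phase γ φ - 1)` one has `dφ = (∑ b k * u ^ (2 * k)) du` as an asymptotic
series at `u = 0`. The error term on the right is chosen so that the estimate holds on all of
`(0, π)`. -/
lemma exists_coeff {γ : ℝ} (h1 : 1 < γ) (h2 : γ ≤ 2) :
    ∃ b : ℕ → ℝ, b 0 = √(2 / idx γ) ∧ ∀ N : ℕ, ∃ M, 0 ≤ M ∧ ∀ φ ∈ Ioo 0 π,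
      |1 - rootDeriv γ φ * ∑ k ∈ Finset.range N, b k * (phase γ φ - 1) ^ k|
        ≤ M * (phase γ φ - 1) ^ N * (1 + rootDeriv γ φ) := by
  obtain ⟨B, hB, hB0, hAB⟩ := exists_phase_eq h1 h2
  have ha := idx_pos h1
  have hBpos : 0 < B 0 := by rw [hB0]; positivity
  have hC := evenAnalytic_phaseSlope γ
  have hC0 : phaseSlope γ 0 ≠ 0 := by rw [phaseSlope_zero]; exact ha.ne'
  have hf : EvenAnalytic (fun x => √(B x) / (phaseSlope γ x / 2)) :=
    (hB.sqrt hBpos).div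
      ⟨hC.analyticAt.fun_div analyticAt_const two_ne_zero, fun x => by rw [hC.even]⟩
      (by simpa using hC0)
  obtain ⟨b, hb0, hb⟩ := hf.exists_expansion hB hBpos.ne'
  refine ⟨b, ?_, fun N => ?_⟩
  · rw [hb0]
    simp only [phaseSlope_zero, hB0]
    rw [eq_comm, Real.sqrt_eq_iff_mul_self_eq (by positivity) (by positivity)]
    have : √(idx γ / 2) * √(idx γ / 2) = idx γ / 2 := Real.mul_self_sqrt (by positivity)
    field_simp
    field_simp at this
    linarith
  · obtain ⟨g, hg, hfg⟩ := hb N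
    -- near `0`
    have hgb : ∀ᶠ x in 𝓝 (0 : ℝ), |g x| < |g 0| + 1 :=
      hg.analyticAt.continuousAt.abs.eventually_lt_const (by linarith)
    have hnear := (hfg.and hgb)
    rw [Metric.eventually_nhds_iff] at hnear
    obtain ⟨δ, hδ, hnear⟩ := hnear
    -- away from `0` the function `phase γ - 1` is bounded below by `ε`
    set δ' := min (δ / 2) (π / 2) with hδ'
    have hδ'0 : 0 < δ' := by positivity
    have hδ'π : δ' < π := (min_le_right _ _).trans_lt (by linarith [pi_pos])
    have hδ'δ : δ' < δ := (min_le_left _ _).trans_lt (by linarith)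
    set ε := phase γ δ' - 1 with hε
    have hε0 : 0 < ε := sub_pos.2 (one_lt_phase h1 h2 hδ'0 hδ'π)
    set S := ∑ k ∈ Finset.range N, |b k| * ε⁻¹ ^ (N - k) with hS
    have hS0 : 0 ≤ S := Finset.sum_nonneg fun k _ => by positivity
    refine ⟨(|g 0| + 1) + ε⁻¹ ^ N + S, by positivity, ?_⟩
    rintro φ ⟨h0, hπ⟩
    have hE : 0 < phase γ φ - 1 := sub_pos.2 (one_lt_phase h1 h2 h0 hπ)
    have hr := rootDeriv_pos h1 h2 h0 hπ
    have hs := phaseSlope_pos h1 h2 h0 hπ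
    rcases lt_or_ge φ δ' with hlt | hge
    · obtain ⟨e1, e2⟩ := hnear (y := φ) (by
        rw [dist_zero_right, norm_eq_abs, abs_of_pos h0]; exact hlt.trans hδ'δ)
      rw [← hAB] at e1
      have hBφ : 0 < B φ := by
        have := hAB φ ▸ hE
        exact pos_of_mul_pos_right this (by positivity)
      have hone : rootDeriv γ φ * (√(B φ) / (phaseSlope γ φ / 2)) = 1 := by
        rw [rootDeriv, hAB φ, Real.sqrt_mul (by positivity), Real.sqrt_sq h0.le]
        have := Real.sqrt_pos.2 hBφ
        field_simp
      have : 1 - rootDeriv γ φ * ∑ k ∈ Finset.range N, b k * (phase γ φ - 1) ^ k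
          = rootDeriv γ φ * ((phase γ φ - 1) ^ N * g φ) := by
        linear_combination (-1) * hone + rootDeriv γ φ * e1
      rw [this, abs_mul, abs_mul, abs_of_pos hr, abs_of_pos (pow_pos hE N)]
      have hEN := pow_pos hE N
      calc rootDeriv γ φ * ((phase γ φ - 1) ^ N * |g φ|)
          ≤ rootDeriv γ φ * ((phase γ φ - 1) ^ N * (|g 0| + 1)) := by gcongr
        _ = (|g 0| + 1) * (phase γ φ - 1) ^ N * rootDeriv γ φ := by ring
        _ ≤ ((|g 0| + 1) + ε⁻¹ ^ N + S) * (phase γ φ - 1) ^ N * (1 + rootDeriv γ φ) := by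
            have i1 : 0 ≤ (ε⁻¹ ^ N + S) * (phase γ φ - 1) ^ N * (1 + rootDeriv γ φ) := by positivity
            have i2 : 0 ≤ (|g 0| + 1) * (phase γ φ - 1) ^ N := by positivity
            linarith
    · have hεE : ε ≤ phase γ φ - 1 :=
        sub_le_sub_right ((strictMonoOn_phase h1 h2).monotoneOn ⟨hδ'0.le, hδ'π⟩ ⟨h0.le, hπ⟩ hge) 1
      have hpow : ∀ k ≤ N, (phase γ φ - 1) ^ k ≤ ε⁻¹ ^ (N - k) * (phase γ φ - 1) ^ N := by
        intro k hk
        obtain ⟨m, rfl⟩ := Nat.exists_eq_add_of_le hk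
        rw [Nat.add_sub_cancel_left, pow_add, inv_pow, inv_mul_eq_div, le_div_iff₀ (by positivity)]
        gcongr
      have hsum : |∑ k ∈ Finset.range N, b k * (phase γ φ - 1) ^ k| ≤ S * (phase γ φ - 1) ^ N := by
        refine (Finset.abs_sum_le_sum_abs _ _).trans ?_
        rw [hS, Finset.sum_mul]
        refine Finset.sum_le_sum fun k hk => ?_
        rw [abs_mul, abs_of_pos (pow_pos hE k), mul_assoc]
        exact mul_le_mul_of_nonneg_left (hpow k (Finset.mem_range.1 hk).le) (abs_nonneg _)
      have hone := hpow 0 (Nat.zero_le N)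
      rw [pow_zero, Nat.sub_zero] at hone
      have hEN := pow_pos hE N
      have hεN : 0 ≤ ε⁻¹ ^ N := by positivity
      calc |1 - rootDeriv γ φ * ∑ k ∈ Finset.range N, b k * (phase γ φ - 1) ^ k|
          ≤ 1 + rootDeriv γ φ * |∑ k ∈ Finset.range N, b k * (phase γ φ - 1) ^ k| := by
            refine (abs_sub _ _).trans ?_
            rw [abs_one, abs_mul, abs_of_pos hr]
        _ ≤ ε⁻¹ ^ N * (phase γ φ - 1) ^ N + rootDeriv γ φ * (S * (phase γ φ - 1) ^ N) := by
            gcongr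
        _ ≤ ((|g 0| + 1) + ε⁻¹ ^ N + S) * (phase γ φ - 1) ^ N * (1 + rootDeriv γ φ) := by
            have i1 : 0 ≤ (|g 0| + 1 + S) * (phase γ φ - 1) ^ N := by positivity
            have i2 : 0 ≤ (|g 0| + 1 + ε⁻¹ ^ N) * (phase γ φ - 1) ^ N * rootDeriv γ φ := by
              positivity
            linarith

/-- The substitution `t = phase γ φ - 1` turns Laplace moments into Gamma integrals. -/
lemma rootDeriv_moment {γ : ℝ} (h1 : 1 < γ) (h2 : γ ≤ 2) (k : ℕ) {y : ℝ} (hy : 0 < y) :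
    IntegrableOn (fun φ => rootDeriv γ φ * ((phase γ φ - 1) ^ k * exp (-(y * (phase γ φ - 1)))))
        (Ioo 0 π) ∧
      ∫ φ in Ioo 0 π, rootDeriv γ φ * ((phase γ φ - 1) ^ k * exp (-(y * (phase γ φ - 1))))
        = Real.Gamma (k + 1 / 2) / 2 * y⁻¹ ^ k / √y := by
  have hder : ∀ x ∈ Ioo 0 π, HasDerivWithinAt (fun φ => phase γ φ - 1) (x * phaseSlope γ x)
      (Ioo 0 π) x := fun x hx => ((hasDerivAt_phase h1 h2 hx.1 hx.2).sub_const 1).hasDerivWithinAt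
  have hinj : InjOn (fun φ => phase γ φ - 1) (Ioo 0 π) := by
    intro x hx z hz hxz
    exact (strictMonoOn_phase h1 h2).injOn ⟨hx.1.le, hx.2⟩ ⟨hz.1.le, hz.2⟩ (sub_left_inj.1 hxz)
  let G : ℝ → ℝ := fun t => (1 / (2 * √t)) * (t ^ k * exp (-(y * t)))
  have hG : ∀ t ∈ Ioi (0 : ℝ), G t = 1 / 2 * (t ^ ((k + 1 / 2 : ℝ) - 1) * exp (-(y * t))) := by
    intro t ht
    have ht : 0 < t := ht
    have : t ^ ((k + 1 / 2 : ℝ) - 1) = t ^ k / √t := by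
      rw [show (k + 1 / 2 : ℝ) - 1 = k - 1 / 2 by ring, rpow_sub ht, rpow_natCast, sqrt_eq_rpow]
    simp only [G]
    rw [this]
    field_simp
  have hcongr : ∀ x ∈ Ioo 0 π, |x * phaseSlope γ x| • G (phase γ x - 1)
      = rootDeriv γ x * ((phase γ x - 1) ^ k * exp (-(y * (phase γ x - 1)))) := by
    intro x hx
    rw [abs_of_pos (mul_pos hx.1 (phaseSlope_pos h1 h2 hx.1 hx.2)), smul_eq_mul]
    simp only [G, rootDeriv]
    ring
  have hk : (0 : ℝ) < k + 1 / 2 := by positivity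
  have hval := integral_rpow_mul_exp_neg_mul_Ioi hk hy
  have hint : IntegrableOn (fun t : ℝ => t ^ ((k + 1 / 2 : ℝ) - 1) * exp (-(y * t))) (Ioi 0) := by
    by_contra hcon
    rw [integral_undef hcon] at hval
    have := Real.Gamma_pos_of_pos hk
    have : 0 < (1 / y) ^ (k + 1 / 2 : ℝ) * Real.Gamma (k + 1 / 2) := by positivity
    linarith
  constructor
  · rw [integrableOn_congr_fun (fun x hx => (hcongr x hx).symm) measurableSet_Ioo]
    rw [← integrableOn_image_iff_integrableOn_abs_deriv_smul measurableSet_Ioo hder hinj G,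
      image_phase h1 h2, integrableOn_congr_fun hG measurableSet_Ioi]
    exact hint.const_mul _
  · rw [setIntegral_congr_fun measurableSet_Ioo (fun x hx => (hcongr x hx).symm),
      ← integral_image_eq_integral_abs_deriv_smul measurableSet_Ioo hder hinj G,
      image_phase h1 h2, setIntegral_congr_fun measurableSet_Ioi hG, integral_const_mul, hval,
      rpow_add (by positivity), rpow_natCast, one_div y, one_div (2 : ℝ), ← one_div (2 : ℝ),
      ← sqrt_eq_rpow, Real.sqrt_inv]
    ring

lemma integrableOn_phase_moment {γ : ℝ} (h1 : 1 < γ) (h2 : γ ≤ 2) (j : ℕ) {y : ℝ} (hy : 0 < y) :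
    IntegrableOn (fun φ => (phase γ φ - 1) ^ j * exp (-(y * (phase γ φ - 1)))) (Ioo 0 π) := by
  refine Measure.integrableOn_of_bounded (M := j.factorial * y⁻¹ ^ j) (by simp) ?_ ?_
  · have := measurable_phase γ
    exact Measurable.aestronglyMeasurable (by fun_prop)
  · filter_upwards [ae_restrict_mem measurableSet_Ioo] with φ hφ
    have hE : 0 < phase γ φ - 1 := sub_pos.2 (one_lt_phase h1 h2 hφ.1 hφ.2)
    rw [norm_of_nonneg (by positivity)]
    exact pow_mul_exp_neg_le j hE.le hy

/-- **Watson's lemma** for the Laplace moments of `phase γ - 1`, with the same coefficients `b` for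
all the moments. -/
lemma phase_moment_expansion {γ : ℝ} (h1 : 1 < γ) (h2 : γ ≤ 2) :
    ∃ b : ℕ → ℝ, b 0 = √(2 / idx γ) ∧ ∀ j N : ℕ, ∃ M, 0 ≤ M ∧ ∀ y : ℝ, 0 < y →
      |(∫ φ in Ioo 0 π, (phase γ φ - 1) ^ j * exp (-(y * (phase γ φ - 1))))
          - ∑ k ∈ Finset.range N, b k * (Real.Gamma ((k + j : ℕ) + 1 / 2) / 2 * y⁻¹ ^ (k + j) / √y)|
        ≤ M * (y⁻¹ ^ (N + j) * (1 + 1 / √y)) := by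
  obtain ⟨b, hb0, hb⟩ := exists_coeff h1 h2
  refine ⟨b, hb0, fun j N => ?_⟩
  obtain ⟨M, hM0, hM⟩ := hb N
  refine ⟨M * ((N + j).factorial * π + Real.Gamma ((N + j : ℕ) + 1 / 2) / 2), ?_, fun y hy => ?_⟩
  · have := Real.Gamma_pos_of_pos (by positivity : (0 : ℝ) < (N + j : ℕ) + 1 / 2)
    have := pi_pos
    positivity
  have hterm : ∀ k, IntegrableOn (fun φ => b k * (rootDeriv γ φ *
      ((phase γ φ - 1) ^ (k + j) * exp (-(y * (phase γ φ - 1)))))) (Ioo 0 π) :=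
    fun k => (rootDeriv_moment h1 h2 (k + j) hy).1.const_mul _
  have hsum : ∑ k ∈ Finset.range N,
        b k * (Real.Gamma ((k + j : ℕ) + 1 / 2) / 2 * y⁻¹ ^ (k + j) / √y)
      = ∫ φ in Ioo 0 π, ∑ k ∈ Finset.range N, b k * (rootDeriv γ φ *
      ((phase γ φ - 1) ^ (k + j) * exp (-(y * (phase γ φ - 1))))) := by
    rw [integral_finsetSum _ fun k _ => hterm k]
    refine Finset.sum_congr rfl fun k _ => ?_
    rw [integral_const_mul, (rootDeriv_moment h1 h2 (k + j) hy).2]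
  rw [hsum, ← integral_sub (integrableOn_phase_moment h1 h2 j hy)
    (integrable_finsetSum _ fun k _ => hterm k), ← norm_eq_abs]
  have hi1 := integrableOn_phase_moment h1 h2 (N + j) hy
  have hi2 := rootDeriv_moment h1 h2 (N + j) hy
  have hbound : ∀ᵐ φ ∂(volume.restrict (Ioo 0 π)),
      ‖(phase γ φ - 1) ^ j * exp (-(y * (phase γ φ - 1))) -
        ∑ k ∈ Finset.range N, b k * (rootDeriv γ φ *
          ((phase γ φ - 1) ^ (k + j) * exp (-(y * (phase γ φ - 1)))))‖
      ≤ M * ((phase γ φ - 1) ^ (N + j) * exp (-(y * (phase γ φ - 1))) +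
        rootDeriv γ φ * ((phase γ φ - 1) ^ (N + j) * exp (-(y * (phase γ φ - 1))))) := by
    filter_upwards [ae_restrict_mem measurableSet_Ioo] with φ hφ
    have hE : 0 < phase γ φ - 1 := sub_pos.2 (one_lt_phase h1 h2 hφ.1 hφ.2)
    have hfac : (phase γ φ - 1) ^ j * exp (-(y * (phase γ φ - 1))) -
        ∑ k ∈ Finset.range N, b k * (rootDeriv γ φ *
          ((phase γ φ - 1) ^ (k + j) * exp (-(y * (phase γ φ - 1)))))
        = ((phase γ φ - 1) ^ j * exp (-(y * (phase γ φ - 1)))) *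
          (1 - rootDeriv γ φ * ∑ k ∈ Finset.range N, b k * (phase γ φ - 1) ^ k) := by
      rw [mul_one_sub, ← mul_assoc, Finset.mul_sum]
      congr 1
      refine Finset.sum_congr rfl fun k _ => ?_
      rw [pow_add]
      ring
    have hp : 0 ≤ (phase γ φ - 1) ^ j * exp (-(y * (phase γ φ - 1))) := by positivity
    rw [hfac, norm_mul, norm_of_nonneg hp, norm_eq_abs]
    refine (mul_le_mul_of_nonneg_left (hM φ hφ) hp).trans (le_of_eq ?_)
    rw [pow_add]
    ring
  refine (norm_integral_le_of_norm_le ((hi1.add hi2.1).const_mul M) hbound).trans ?_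
  simp only [Pi.add_apply]
  rw [integral_const_mul, integral_add hi1 hi2.1, hi2.2, mul_assoc]
  refine mul_le_mul_of_nonneg_left ?_ hM0
  have hmass : ∫ φ in Ioo 0 π, (phase γ φ - 1) ^ (N + j) * exp (-(y * (phase γ φ - 1)))
      ≤ (N + j).factorial * y⁻¹ ^ (N + j) * π := by
    have : ∫ φ in Ioo 0 π, (N + j).factorial * y⁻¹ ^ (N + j)
        = (N + j).factorial * y⁻¹ ^ (N + j) * π := by
      rw [setIntegral_const]
      simp [pi_pos.le, mul_comm]
    rw [← this]
    refine setIntegral_mono_on hi1 (integrableOn_const (by simp)) measurableSet_Ioo fun φ hφ => ?_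
    exact pow_mul_exp_neg_le _ (sub_pos.2 (one_lt_phase h1 h2 hφ.1 hφ.2)).le hy
  have hG := Real.Gamma_pos_of_pos (by positivity : (0 : ℝ) < (N + j : ℕ) + 1 / 2)
  have i1 : 0 ≤ (N + j).factorial * π * y⁻¹ ^ (N + j) * (1 / √y) := by
    have := pi_pos
    positivity
  have i2 : 0 ≤ Real.Gamma ((N + j : ℕ) + 1 / 2) / 2 * y⁻¹ ^ (N + j) := by positivity
  rw [div_eq_mul_one_div _ (√y)]
  nlinarith [i1, i2, hmass]

/-! ### Deformation of the path to the negative real axis -/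

/-- The entire function `w ↦ exp (c * exp w - d * exp (a * w))`: the integrand
`exp (c * z - d * z ^ a)` in the coordinate `z = exp w`. -/
noncomputable def expIntegrand (c d a : ℝ) (w : ℂ) : ℂ :=
  Complex.exp (c * Complex.exp w - d * Complex.exp (a * w))

/-- Minus the imaginary part of `expIntegrand c d a` on the line `Im w = π`. -/
noncomputable def jump (c d a t : ℝ) : ℝ :=
  exp (-(c * exp t) - d * (exp (a * t) * cos (a * π))) * sin (d * (exp (a * t) * sin (a * π)))

lemma differentiable_expIntegrand (c d a : ℝ) : Differentiable ℂ (expIntegrand c d a) := by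
  unfold expIntegrand
  fun_prop

lemma exponent_eq (c d a t θ : ℝ) :
    (c : ℂ) * Complex.exp (t + θ * Complex.I) - d * Complex.exp (a * (t + θ * Complex.I)) =
      ((c * (exp t * cos θ) - d * (exp (a * t) * cos (a * θ)) : ℝ) : ℂ) +
        ((c * (exp t * sin θ) - d * (exp (a * t) * sin (a * θ)) : ℝ) : ℂ) * Complex.I := by
  have e : (a : ℂ) * (t + θ * Complex.I) = ((a * t : ℝ) : ℂ) + ((a * θ : ℝ) : ℂ) * Complex.I := by
    push_cast; ring
  rw [e, Complex.exp_add, Complex.exp_add, Complex.exp_mul_I, Complex.exp_mul_I]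
  push_cast
  ring

lemma exponent_re (c d a t θ : ℝ) :
    ((c : ℂ) * Complex.exp (t + θ * Complex.I) - d * Complex.exp (a * (t + θ * Complex.I))).re =
      c * (exp t * cos θ) - d * (exp (a * t) * cos (a * θ)) := by
  rw [exponent_eq, Complex.add_re, Complex.ofReal_re, Complex.re_ofReal_mul, Complex.I_re, mul_zero,
    add_zero]

lemma exponent_im (c d a t θ : ℝ) :
    ((c : ℂ) * Complex.exp (t + θ * Complex.I) - d * Complex.exp (a * (t + θ * Complex.I))).im =
      c * (exp t * sin θ) - d * (exp (a * t) * sin (a * θ)) := by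
  rw [exponent_eq, Complex.add_im, Complex.ofReal_im, Complex.im_ofReal_mul, Complex.I_im, mul_one,
    zero_add]

lemma norm_expIntegrand (c d a t θ : ℝ) :
    ‖expIntegrand c d a (t + θ * Complex.I)‖
      = exp (c * (exp t * cos θ) - d * (exp (a * t) * cos (a * θ))) := by
  rw [expIntegrand, Complex.norm_exp, exponent_re]

lemma expIntegrand_im (c d a t θ : ℝ) :
    (expIntegrand c d a (t + θ * Complex.I)).im
      = exp (c * (exp t * cos θ) - d * (exp (a * t) * cos (a * θ))) *
        sin (c * (exp t * sin θ) - d * (exp (a * t) * sin (a * θ))) := by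
  rw [expIntegrand, Complex.exp_im, exponent_re, exponent_im]

lemma expIntegrand_re (c d a t θ : ℝ) :
    (expIntegrand c d a (t + θ * Complex.I)).re
      = exp (c * (exp t * cos θ) - d * (exp (a * t) * cos (a * θ))) *
        cos (c * (exp t * sin θ) - d * (exp (a * t) * sin (a * θ))) := by
  rw [expIntegrand, Complex.exp_re, exponent_re, exponent_im]

lemma expIntegrand_im_pi (c d a t : ℝ) :
    (expIntegrand c d a (t + π * Complex.I)).im = - jump c d a t := by
  rw [expIntegrand_im, jump, cos_pi, sin_pi, mul_zero, mul_zero, zero_sub, sin_neg]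
  ring_nf

lemma continuous_jump (c d a : ℝ) : Continuous (jump c d a) := by
  unfold jump
  fun_prop

lemma abs_jump_le {c d a : ℝ} (hd : 0 ≤ d) (ha : 0 ≤ a) (ha' : a ≤ 1 / 2) (t : ℝ) :
    |jump c d a t| ≤ d * (exp (a * t) * exp (-(c * exp t))) := by
  have hcos : 0 ≤ cos (a * π) :=
    cos_nonneg_of_mem_Icc ⟨by nlinarith [pi_pos], by nlinarith [pi_pos]⟩
  rw [jump, abs_mul, abs_of_pos (exp_pos _)]
  have h1 : exp (-(c * exp t) - d * (exp (a * t) * cos (a * π))) ≤ exp (-(c * exp t)) := by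
    apply exp_le_exp.2
    have : 0 ≤ d * (exp (a * t) * cos (a * π)) := by positivity
    linarith
  have h2 : |sin (d * (exp (a * t) * sin (a * π)))| ≤ d * exp (a * t) := by
    refine abs_sin_le_abs.trans ?_
    rw [abs_mul, abs_mul, abs_of_nonneg hd, abs_of_pos (exp_pos _)]
    have := abs_sin_le_one (a * π)
    have := exp_pos (a * t)
    gcongr
    nlinarith
  calc _ ≤ exp (-(c * exp t)) * (d * exp (a * t)) := by gcongr
    _ = _ := by ring

lemma integrable_exp_mul_exp_neg {c a : ℝ} (hc : 0 < c) (ha : 0 < a) :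
    Integrable (fun t : ℝ => exp (a * t) * exp (-(c * exp t))) := by
  have hint : IntegrableOn (fun t : ℝ => t ^ (a - 1) * exp (-(c * t))) (Ioi 0) := by
    by_contra hcon
    have hval := integral_rpow_mul_exp_neg_mul_Ioi ha hc
    rw [integral_undef hcon] at hval
    have := Real.Gamma_pos_of_pos ha
    have : 0 < (1 / c) ^ a * Real.Gamma a := by positivity
    linarith
  have himg : exp '' univ = Ioi 0 := by rw [image_univ, range_exp]
  rw [← himg, integrableOn_image_iff_integrableOn_abs_deriv_smul MeasurableSet.univ
    (fun x _ => (hasDerivAt_exp x).hasDerivWithinAt) exp_injective.injOn, integrableOn_univ] at hint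
  refine hint.congr (ae_of_all _ fun t => ?_)
  simp only [smul_eq_mul, abs_of_pos (exp_pos t)]
  rw [← exp_mul, ← mul_assoc, ← exp_add]
  ring_nf

lemma integrable_jump {c d a : ℝ} (hc : 0 < c) (hd : 0 ≤ d) (ha : 0 < a) (ha' : a ≤ 1 / 2) :
    Integrable (jump c d a) :=
  ((integrable_exp_mul_exp_neg hc ha).const_mul d).mono'
    (continuous_jump c d a).aestronglyMeasurable
    (ae_of_all _ fun t => abs_jump_le hd ha.le ha' t)

lemma hasDerivAt_line (t θ : ℝ) :
    HasDerivAt (fun θ : ℝ => (t : ℂ) + θ * Complex.I) Complex.I θ := by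
  simpa using ((Complex.ofRealCLM.hasDerivAt (x := θ)).mul_const Complex.I).const_add (t : ℂ)

lemma hasDerivAt_line' (t θ : ℝ) :
    HasDerivAt (fun t : ℝ => (t : ℂ) + θ * Complex.I) 1 t := by
  simpa using (Complex.ofRealCLM.hasDerivAt (x := t)).add_const ((θ : ℂ) * Complex.I)

lemma _root_.HasDerivAt.complex_im {f : ℝ → ℂ} {f' : ℂ} {x : ℝ} (h : HasDerivAt f f' x) :
    HasDerivAt (fun x => (f x).im) f'.im x :=
  Complex.imCLM.hasFDerivAt.comp_hasDerivAt x h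

/-- Uniform convergence of `expIntegrand` to `1` at the left end of the strip `|Im w| ≤ π`. -/
lemma tendsto_norm_expIntegrand_sub_one {c d a : ℝ} (hc : 0 ≤ c) (hd : 0 ≤ d) (ha : 0 < a) {ε : ℝ}
    (hε : 0 < ε) : ∀ᶠ t : ℝ in atBot, ∀ θ : ℝ,
      ‖expIntegrand c d a (t + θ * Complex.I) - 1‖ ≤ ε := by
  have h1 : Tendsto (fun t : ℝ => c * exp t + d * exp (a * t)) atBot (𝓝 0) := by
    have := (tendsto_exp_atBot.const_mul c).add
      ((tendsto_exp_atBot.comp (tendsto_id.const_mul_atBot ha)).const_mul d)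
    simpa using this
  filter_upwards [h1.eventually_lt_const (lt_min one_pos (half_pos hε))] with t ht θ
  have hn : ‖(c : ℂ) * Complex.exp (t + θ * Complex.I) - d * Complex.exp (a * (t + θ * Complex.I))‖
      ≤ c * exp t + d * exp (a * t) := by
    refine (norm_sub_le _ _).trans (le_of_eq ?_)
    rw [norm_mul, norm_mul, Complex.norm_exp, Complex.norm_exp]
    simp [abs_of_nonneg, hc, hd]
  have h2 := Complex.norm_exp_sub_one_le (hn.trans (ht.le.trans (min_le_left _ _)))
  refine h2.trans ?_
  linarith [ht.le.trans (min_le_right _ _)]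

/-- Deformation of the upper half of the steepest descent path to the upper side of the negative
real axis, which is the line `Im w = π` in the coordinate `z = exp w`. -/
lemma integral_exp_phase {γ : ℝ} (h1 : 1 < γ) (h2 : γ ≤ 2) {y : ℝ} (hy : 0 < y) :
    ∫ φ in Ioo 0 π, exp (-(y * phase γ φ))
      = π - ∫ t, jump (y * (γ - 1)) (y * γ) (idx γ) t := by
  set a := idx γ with ha_def
  set c := y * (γ - 1) with hc_def
  set d := y * γ with hd_def
  have ha : 0 < a := idx_pos h1
  have ha' : a ≤ 1 / 2 := idx_le_half h1 h2
  have hc : 0 < c := mul_pos hy (by linarith)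
  have hd : 0 < d := mul_pos hy (by linarith)
  obtain ⟨P, hP⟩ := (differentiable_expIntegrand c d a).isExactOn_univ
  replace hP : ∀ z, HasDerivAt P (expIntegrand c d a z) z := fun z => hP z (mem_univ z)
  have hPc : Continuous P := continuous_iff_continuousAt.2 fun z => (hP z).continuousAt
  -- vertical and horizontal derivatives of the primitive
  have hver : ∀ t θ : ℝ, HasDerivAt (fun θ : ℝ => P (t + θ * Complex.I))
      (Complex.I * expIntegrand c d a (t + θ * Complex.I)) θ := fun t θ =>
    (hP _).scomp θ (hasDerivAt_line t θ)
  have hhor : ∀ θ t : ℝ, HasDerivAt (fun t : ℝ => P (t + θ * Complex.I))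
      (expIntegrand c d a (t + θ * Complex.I)) t := fun θ t => by
    have := (hP _).scomp t (hasDerivAt_line' t θ)
    rw [one_smul] at this
    exact this
  -- the imaginary part of the primitive on the real axis
  have hreal : ∀ t : ℝ, (P t).im = (P 0).im := by
    have hder : ∀ t : ℝ, HasDerivAt (fun t : ℝ => (P (t + (0 : ℝ) * Complex.I)).im) 0 t := by
      intro t
      have := (hhor 0 t).complex_im
      rwa [expIntegrand_im, sin_zero, mul_zero, mul_zero, mul_zero, sin_zero, mul_zero, mul_zero,
        sub_zero, sin_zero, mul_zero] at this
    intro t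
    have := is_const_of_deriv_eq_zero (fun t => (hder t).differentiableAt)
      (fun t => (hder t).deriv) t 0
    simpa using this
  -- on the upper edge
  have hup : ∀ t : ℝ, HasDerivAt (fun t : ℝ => (P (t + π * Complex.I)).im) (- jump c d a t) t := by
    intro t
    have := (hhor π t).complex_im
    rwa [expIntegrand_im_pi] at this
  have hint := integrable_jump hc hd.le ha ha'
  have hbot : Tendsto (fun t : ℝ => (P (t + π * Complex.I)).im) atBot (𝓝 ((P 0).im + π)) := by
    rw [Metric.tendsto_nhds]
    intro ε hε
    have hε' : 0 < ε / (2 * π) := by have := pi_pos; positivity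
    filter_upwards [tendsto_norm_expIntegrand_sub_one hc.le hd.le ha hε'] with t ht
    have hder : ∀ θ ∈ Icc 0 π, HasDerivWithinAt (fun θ : ℝ => P (t + θ * Complex.I) -
        ((0 : ℝ) + θ * Complex.I)) (Complex.I * expIntegrand c d a (t + θ * Complex.I) - Complex.I)
        (Icc 0 π) θ := fun θ _ => ((hver t θ).sub (hasDerivAt_line 0 θ)).hasDerivWithinAt
    have := norm_image_sub_le_of_norm_deriv_le_segment' hder (C := ε / (2 * π)) (fun θ _ => by
      rw [show Complex.I * expIntegrand c d a (t + θ * Complex.I) - Complex.I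
        = Complex.I * (expIntegrand c d a (t + θ * Complex.I) - 1) by ring, norm_mul,
        Complex.norm_I, one_mul]
      exact ht θ) π ⟨pi_pos.le, le_rfl⟩
    have him := (Complex.abs_im_le_norm _).trans this
    simp only [Complex.ofReal_zero, zero_add, zero_mul, add_zero, sub_zero, Complex.sub_im,
      Complex.mul_im, Complex.ofReal_re, Complex.I_im, mul_one, Complex.ofReal_im, Complex.I_re,
      mul_zero, hreal] at him
    rw [Real.dist_eq]
    have e : ε / (2 * π) * π = ε / 2 := by field_simp
    rw [e] at him
    calc _ = |(P (t + π * Complex.I)).im - π - (P 0).im| := by congr 1; ring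
      _ ≤ ε / 2 := him
      _ < ε := by linarith
  have htop : Tendsto (fun t : ℝ => (P (t + π * Complex.I)).im) atTop
      (𝓝 (limUnder atTop fun t : ℝ => (P (t + π * Complex.I)).im)) :=
    tendsto_limUnder_of_hasDerivAt_of_integrableOn_Ioi (a := 0) (fun t _ => hup t)
      hint.neg.integrableOn
  set L := limUnder atTop fun t : ℝ => (P (t + π * Complex.I)).im
  have htotal := integral_of_hasDerivAt_of_tendsto hup hint.neg hbot htop
  rw [integral_neg] at htotal
  -- along the steepest descent path
  have hpath : ∀ φ ∈ Ioo 0 π, HasDerivAt (fun φ : ℝ => (P (logRad γ φ + φ * Complex.I)).im)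
      (exp (-(y * phase γ φ))) φ := by
    intro φ hφ
    have e1 : HasDerivAt (fun φ : ℝ => (logRad γ φ : ℂ) + φ * Complex.I)
        (((γ * (a * cos (a * φ) / sin (a * φ) - cos φ / sin φ) : ℝ) : ℂ) + Complex.I) φ := by
      have := (hasDerivAt_logRad h1 h2 hφ.1 hφ.2).ofReal_comp.add (hasDerivAt_line 0 φ)
      refine this.congr_of_eventuallyEq (Eventually.of_forall fun x => ?_)
      simp
    have e2 := ((hP _).scomp φ e1).complex_im
    refine e2.congr_deriv ?_
    have hz : c * (exp (logRad γ φ) * sin φ) - d * (exp (a * logRad γ φ) * sin (a * φ)) = 0 := by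
      rw [← exp_logRad_mul_sin h1 h2 hφ.1 hφ.2, hc_def, hd_def]
      linear_combination (-(y * (exp (logRad γ φ) * sin φ))) * gamma_mul_idx h1
    rw [smul_eq_mul, Complex.mul_im, expIntegrand_im, expIntegrand_re, hz, sin_zero, cos_zero]
    simp only [Complex.add_im, Complex.ofReal_im, Complex.I_im, zero_add, mul_zero, mul_one,
      one_mul]
    congr 1
    rw [phase, hc_def, hd_def]
    ring
  have hstart : Tendsto (fun φ : ℝ => (P (logRad γ φ + φ * Complex.I)).im) (𝓝[>] 0)
      (𝓝 (P 0).im) := by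
    have hc0 : ContinuousAt (fun φ : ℝ => (P (logRad γ φ + φ * Complex.I)).im) 0 := by
      have hl := (evenAnalytic_logRad γ).analyticAt.continuousAt
      have hin : ContinuousAt (fun φ : ℝ => (logRad γ φ : ℂ) + φ * Complex.I) 0 :=
        (Complex.continuous_ofReal.continuousAt.comp hl).add (by fun_prop)
      exact (Complex.continuous_im.comp hPc).continuousAt.comp hin
    have := hc0.tendsto.mono_left (nhdsWithin_le_nhds (s := Ioi 0))
    simpa [logRad_zero] using this
  have hend : Tendsto (fun φ : ℝ => (P (logRad γ φ + φ * Complex.I)).im) (𝓝[<] π) (𝓝 L) := by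
    have hlim := htop.comp (tendsto_logRad h1 h2)
    have hdiff : Tendsto (fun φ : ℝ => (P (logRad γ φ + φ * Complex.I)).im -
        (P (logRad γ φ + π * Complex.I)).im) (𝓝[<] π) (𝓝 0) := by
      have hπ0 : Tendsto (fun φ : ℝ => π - φ) (𝓝[<] π) (𝓝 0) := by
        have : Tendsto (fun φ : ℝ => π - φ) (𝓝 π) (𝓝 (π - π)) :=
          Continuous.tendsto (by fun_prop) π
        rw [sub_self] at this
        exact this.mono_left nhdsWithin_le_nhds
      refine squeeze_zero_norm' ?_ hπ0
      filter_upwards [Ioo_mem_nhdsLT (by linarith [pi_pos] : π / 2 < π)] with φ hφ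
      have := norm_image_sub_le_of_norm_deriv_le_segment' (C := 1)
        (fun θ (_ : θ ∈ Icc φ π) => (hver (logRad γ φ) θ).hasDerivWithinAt) (fun θ hθ => by
          rw [norm_mul, Complex.norm_I, one_mul, norm_expIntegrand]
          rw [exp_le_one_iff]
          have i1 : cos θ ≤ 0 := cos_nonpos_of_pi_div_two_le_of_le (by linarith [hφ.1, hθ.1])
            (by linarith [hθ.2, pi_pos])
          have i2 : 0 ≤ cos (a * θ) := by
            have h0θ : 0 < θ := by linarith [hφ.1, hθ.1, pi_pos]
            exact cos_nonneg_of_mem_Icc ⟨by nlinarith [pi_pos], by nlinarith [hθ.2]⟩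
          have i3 : 0 ≤ d * (exp (a * logRad γ φ) * cos (a * θ)) := by positivity
          have i4 : c * (exp (logRad γ φ) * cos θ) ≤ 0 :=
            mul_nonpos_of_nonneg_of_nonpos hc.le
              (mul_nonpos_of_nonneg_of_nonpos (exp_pos _).le i1)
          linarith) π ⟨hφ.2.le, le_rfl⟩
      rw [norm_eq_abs, abs_sub_comm, ← Complex.sub_im]
      refine (Complex.abs_im_le_norm _).trans ?_
      linarith
    have := hdiff.add hlim
    simpa using this
  have hK : IntervalIntegrable (fun φ => exp (-(y * phase γ φ))) volume 0 π := by
    rw [intervalIntegrable_iff_integrableOn_Ioo_of_le pi_pos.le]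
    refine Measure.integrableOn_of_bounded (M := 1) (by simp) ?_ ?_
    · have := measurable_phase γ
      exact Measurable.aestronglyMeasurable (by fun_prop)
    · filter_upwards [ae_restrict_mem measurableSet_Ioo] with φ hφ
      rw [norm_of_nonneg (exp_pos _).le, exp_le_one_iff]
      have := one_lt_phase h1 h2 hφ.1 hφ.2
      nlinarith
  have hfin := intervalIntegral.integral_eq_sub_of_hasDerivAt_of_tendsto pi_pos hpath hK hstart hend
  rw [intervalIntegral.integral_of_le pi_pos.le, integral_Ioc_eq_integral_Ioo] at hfin
  rw [hfin]
  linarith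

/-! ### Stieltjes representation and Laplace transform -/

lemma norm_expIntegrand_zero_le {d a : ℝ} (hd : 0 ≤ d) (ha : 0 ≤ a) (ha' : a ≤ 1 / 2) (t : ℝ)
    {θ : ℝ} (hθ : |θ| ≤ π) : ‖expIntegrand 0 d a (t + θ * Complex.I)‖ ≤ 1 := by
  rw [norm_expIntegrand, exp_le_one_iff, zero_mul, zero_sub, neg_nonpos]
  have : 0 ≤ cos (a * θ) := by
    rw [← cos_abs, abs_mul, abs_of_nonneg ha]
    have := abs_nonneg θ
    exact cos_nonneg_of_mem_Icc ⟨by nlinarith [pi_pos], by nlinarith [pi_pos]⟩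
  positivity

/-- The difference quotient of `g = expIntegrand 0 d a` at `log lam`, arranged so that off `log lam`
it is `lam * (g w - g (log lam)) / (lam - exp w)` and the singularity at `log lam` is removed. -/
noncomputable def cauchyKernel (lam d a : ℝ) (w : ℂ) : ℂ :=
  -lam * dslope (expIntegrand 0 d a) (log lam) w / dslope Complex.exp (log lam) w

lemma differentiable_dslope {f : ℂ → ℂ} (hf : Differentiable ℂ f) (c : ℂ) :
    Differentiable ℂ (dslope f c) :=
  differentiableOn_univ.1 ((Complex.differentiableOn_dslope univ_mem).2 hf.differentiableOn)

section Kernel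

variable {lam d a : ℝ}

/-- In the closed strip `|Im w| ≤ π`, the only solution of `exp w = lam` is `log lam`. -/
lemma exp_ne_of_im_le (hlam : 0 < lam) {w : ℂ} (hw : |w.im| ≤ π) (hne : w ≠ log lam) :
    Complex.exp w ≠ lam := by
  intro h
  have h' : Complex.exp w = Complex.exp (log lam) := by
    rw [h, ← Complex.ofReal_exp, exp_log hlam]
  obtain ⟨n, hn⟩ := Complex.exp_eq_exp_iff_exists_int.1 h'
  have him : w.im = n * (2 * π) := by
    rw [hn]
    simp
  rw [him, abs_mul, abs_of_pos (by positivity : (0 : ℝ) < 2 * π)] at hw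
  have hn1 : |(n : ℝ)| < 1 := by nlinarith [pi_pos]
  have hn0 : n = 0 := by
    rw [← Int.cast_abs] at hn1
    exact Int.abs_lt_one_iff.1 (by exact_mod_cast hn1)
  rw [hn0] at hn
  apply hne
  simpa using hn

lemma cauchyKernel_apply (hlam : 0 < lam) {w : ℂ} (hne : w ≠ log lam) :
    cauchyKernel lam d a w
      = lam / (lam - Complex.exp w) * (expIntegrand 0 d a w - expIntegrand 0 d a (log lam)) := by
  have he : Complex.exp (log lam) = lam := by rw [← Complex.ofReal_exp, exp_log hlam]
  rw [cauchyKernel, dslope_of_ne _ hne, dslope_of_ne _ hne, slope_def_field, slope_def_field, he]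
  have h1 : w - log lam ≠ 0 := sub_ne_zero.2 hne
  rw [mul_div_assoc, div_div_div_cancel_right₀ h1, ← neg_sub (Complex.exp w), div_neg]
  ring

lemma differentiableAt_cauchyKernel (hlam : 0 < lam) {w : ℂ} (hw : |w.im| ≤ π) :
    DifferentiableAt ℂ (cauchyKernel lam d a) w := by
  refine ((differentiable_dslope (differentiable_expIntegrand 0 d a) _ _).const_mul _).fun_div
    (differentiable_dslope Complex.differentiable_exp _ _) ?_
  rcases eq_or_ne w (log lam) with rfl | hne
  · simp
  · rw [dslope_of_ne _ hne, slope_def_field]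
    refine div_ne_zero (sub_ne_zero.2 ?_) (sub_ne_zero.2 hne)
    rw [← Complex.ofReal_exp, exp_log hlam]
    exact exp_ne_of_im_le hlam hw hne

lemma measurable_cauchyKernel : Measurable (cauchyKernel lam d a) := by
  have h1 := (differentiable_dslope (differentiable_expIntegrand 0 d a) (log lam)).continuous
  have h2 := (differentiable_dslope Complex.differentiable_exp (log lam)).continuous
  exact (h1.measurable.const_mul _).div h2.measurable

lemma norm_cauchyKernel_le (hlam : 0 < lam) (hd : 0 ≤ d) (ha : 0 ≤ a) (ha' : a ≤ 1 / 2) {t θ : ℝ}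
    (hθ : |θ| ≤ π) (ht : exp t ≠ lam) :
    ‖cauchyKernel lam d a (t + θ * Complex.I)‖ ≤ 2 * lam / |lam - exp t| := by
  have hne : (t : ℂ) + θ * Complex.I ≠ log lam := by
    intro h
    have := congrArg Complex.re h
    simp only [Complex.add_re, Complex.ofReal_re, Complex.re_ofReal_mul, Complex.I_re, mul_zero,
      add_zero] at this
    exact ht (by rw [this, exp_log hlam])
  have hpos : 0 < |lam - exp t| := abs_pos.2 (sub_ne_zero.2 ht.symm)
  have hden : |lam - exp t| ≤ ‖(lam : ℂ) - Complex.exp (t + θ * Complex.I)‖ := by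
    have := abs_norm_sub_norm_le (lam : ℂ) (Complex.exp (t + θ * Complex.I))
    rw [Complex.norm_exp] at this
    simpa [abs_of_pos hlam] using this
  rw [cauchyKernel_apply hlam hne, norm_mul, norm_div, Complex.norm_real, norm_of_nonneg hlam.le]
  have hg := norm_expIntegrand_zero_le hd ha ha' t hθ
  have hg' := norm_expIntegrand_zero_le hd ha ha' (log lam) (θ := 0) (by simp [pi_pos.le])
  simp only [Complex.ofReal_zero, zero_mul, add_zero] at hg'
  have h2 : ‖expIntegrand 0 d a (t + θ * Complex.I) - expIntegrand 0 d a (log lam)‖ ≤ 2 :=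
    (norm_sub_le _ _).trans (by linarith)
  calc _ ≤ lam / |lam - exp t| * 2 := by gcongr
    _ = _ := by ring

lemma tendsto_cauchyKernel_right (hlam : 0 < lam) (hd : 0 ≤ d) (ha : 0 ≤ a) (ha' : a ≤ 1 / 2) :
    Tendsto (fun t : ℝ => ∫ θ in -π..π, cauchyKernel lam d a (t + θ * Complex.I)) atTop (𝓝 0) := by
  have h1 : Tendsto (fun t : ℝ => 2 * lam / |lam - exp t| * |π - -π|) atTop (𝓝 0) := by
    have : Tendsto (fun t : ℝ => |lam - exp t|) atTop atTop := by
      refine tendsto_abs_atBot_atTop.comp ?_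
      exact tendsto_atBot_add_const_left _ lam (tendsto_neg_atTop_atBot.comp tendsto_exp_atTop)
    simpa using (this.const_div_atTop (2 * lam)).mul_const |π - -π|
  refine squeeze_zero_norm' ?_ h1
  filter_upwards [tendsto_exp_atTop.eventually_gt_atTop lam] with t ht
  refine intervalIntegral.norm_integral_le_of_norm_le_const fun θ hθ => ?_
  rw [uIoc_of_le (by linarith [pi_pos])] at hθ
  exact norm_cauchyKernel_le hlam hd ha ha' (abs_le.2 ⟨hθ.1.le, hθ.2⟩) ht.ne'

/-- As `Re w → -∞` the kernel tends to `1 - g (log lam)`, while the height of the strip is `2 * π`: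
this is where the value of the Stieltjes transform comes from. -/
lemma tendsto_cauchyKernel_left (hlam : 0 < lam) (hd : 0 ≤ d) (ha : 0 < a) (ha' : a ≤ 1 / 2) :
    Tendsto (fun t : ℝ => ∫ θ in -π..π, cauchyKernel lam d a (t + θ * Complex.I)) atBot
      (𝓝 (2 * π * (1 - expIntegrand 0 d a (log lam)))) := by
  have hconst : ∫ _θ in -π..π, (1 - expIntegrand 0 d a (log lam))
      = 2 * π * (1 - expIntegrand 0 d a (log lam)) := by
    rw [intervalIntegral.integral_const, Complex.real_smul]
    push_cast
    ring
  rw [← hconst]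
  refine intervalIntegral.tendsto_integral_filter_of_dominated_convergence (fun _ => 4) ?_ ?_
    (by simp) ?_
  · refine Eventually.of_forall fun t => Measurable.aestronglyMeasurable ?_
    exact measurable_cauchyKernel.comp (by fun_prop)
  · have : ∀ᶠ t : ℝ in atBot, exp t < lam / 2 :=
      tendsto_exp_atBot.eventually_lt_const (by positivity)
    filter_upwards [this] with t ht
    refine Eventually.of_forall fun θ hθ => ?_
    rw [uIoc_of_le (by linarith [pi_pos])] at hθ
    refine (norm_cauchyKernel_le hlam hd ha.le ha' (abs_le.2 ⟨hθ.1.le, hθ.2⟩)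
      (by linarith)).trans ?_
    rw [abs_of_pos (by linarith), div_le_iff₀ (by linarith)]
    linarith
  · refine Eventually.of_forall fun θ hθ => ?_
    have hexp : Tendsto (fun t : ℝ => Complex.exp (t + θ * Complex.I)) atBot (𝓝 0) := by
      rw [tendsto_zero_iff_norm_tendsto_zero]
      simpa [Complex.norm_exp] using tendsto_exp_atBot
    have hg : Tendsto (fun t : ℝ => expIntegrand 0 d a (t + θ * Complex.I)) atBot (𝓝 1) := by
      rw [Metric.tendsto_nhds]
      intro ε hε
      filter_upwards [tendsto_norm_expIntegrand_sub_one le_rfl hd ha (half_pos hε)] with t ht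
      rw [dist_eq_norm]
      linarith [ht θ]
    have hlam' : (lam : ℂ) ≠ 0 := by exact_mod_cast hlam.ne'
    have hlim : Tendsto (fun t : ℝ => (lam : ℂ) / (lam - Complex.exp (t + θ * Complex.I)) *
        (expIntegrand 0 d a (t + θ * Complex.I) - expIntegrand 0 d a (log lam))) atBot
        (𝓝 ((lam : ℂ) / (lam - 0) * (1 - expIntegrand 0 d a (log lam)))) :=
      (tendsto_const_nhds.div (tendsto_const_nhds.sub hexp) (by simpa using hlam')).mul
        (hg.sub_const _)
    rw [sub_zero, div_self hlam', one_mul] at hlim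
    refine hlim.congr' ?_
    filter_upwards [eventually_lt_atBot (log lam)] with t ht
    rw [cauchyKernel_apply hlam]
    intro h
    have := congrArg Complex.re h
    simp only [Complex.add_re, Complex.ofReal_re, Complex.re_ofReal_mul, Complex.I_re, mul_zero,
      add_zero] at this
    linarith

/-- The jump of the kernel across the negative real axis. -/
lemma cauchyKernel_jump (hlam : 0 < lam) (t : ℝ) :
    (cauchyKernel lam d a (t + (-π : ℝ) * Complex.I)).im
      - (cauchyKernel lam d a (t + (π : ℝ) * Complex.I)).im
      = 2 * (lam / (lam + exp t) * jump 0 d a t) := by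
  have hne : ∀ θ : ℝ, θ ≠ 0 → (t : ℂ) + θ * Complex.I ≠ log lam := by
    intro θ hθ h
    have := congrArg Complex.im h
    simp only [Complex.add_im, Complex.ofReal_im, Complex.im_ofReal_mul, Complex.I_im, mul_one,
      zero_add] at this
    exact hθ this
  have hexp : ∀ θ : ℝ, sin θ = 0 → cos θ = -1 → (lam : ℂ) / (lam - Complex.exp (t + θ * Complex.I))
      = ((lam / (lam + exp t) : ℝ) : ℂ) := by
    intro θ hs hc
    rw [Complex.exp_add, Complex.exp_mul_I, ← Complex.ofReal_cos, ← Complex.ofReal_sin, hs, hc]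
    push_cast
    ring_nf
  have hreal : (expIntegrand 0 d a (log lam)).im = 0 := by
    have := expIntegrand_im 0 d a (log lam) 0
    simpa using this
  rw [cauchyKernel_apply hlam (hne _ (neg_ne_zero.2 pi_ne_zero)),
    cauchyKernel_apply hlam (hne _ pi_ne_zero), hexp _ (by simp) (by simp), hexp _ sin_pi cos_pi,
    Complex.im_ofReal_mul, Complex.im_ofReal_mul, Complex.sub_im, Complex.sub_im, hreal,
    expIntegrand_im_pi, expIntegrand_im, jump, mul_neg, sin_neg, cos_neg, cos_neg, sin_neg]
  rw [zero_mul, zero_mul, zero_sub, zero_sub, mul_neg, mul_neg, neg_neg]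
  ring_nf

lemma integrable_cauchyKernel_jump (hlam : 0 < lam) (hd : 0 ≤ d) (ha : 0 < a) (ha' : a ≤ 1 / 2) :
    Integrable (fun t => lam / (lam + exp t) * |jump 0 d a t|) := by
  have hle : ∀ t, lam / (lam + exp t) * |jump 0 d a t|
      ≤ lam / (lam + exp t) * (d * exp (a * t)) := by
    intro t
    have := abs_jump_le (c := 0) hd ha.le ha' t
    rw [zero_mul, neg_zero, exp_zero, mul_one] at this
    have := exp_pos t
    gcongr
  have hcont : Continuous (fun t => lam / (lam + exp t) * |jump 0 d a t|) :=
    (continuous_const.div (by fun_prop) fun t => by have := exp_pos t; positivity).mul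
      (continuous_jump 0 d a).abs
  have hnn : ∀ t, 0 ≤ lam / (lam + exp t) * |jump 0 d a t| := fun t => by
    have := exp_pos t; positivity
  rw [← integrableOn_univ, ← Iic_union_Ioi (a := (0 : ℝ)), integrableOn_union]
  constructor
  · refine ((integrableOn_exp_mul_Iic ha 0).const_mul d).mono' hcont.aestronglyMeasurable
      (Eventually.of_forall fun t => ?_)
    rw [norm_of_nonneg (hnn t)]
    refine (hle t).trans ?_
    have : lam / (lam + exp t) ≤ 1 := by
      have := exp_pos t
      rw [div_le_one (by positivity)]
      linarith
    have h0 : 0 ≤ d * exp (a * t) := by have := exp_pos (a * t); positivity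
    nlinarith
  · refine ((integrableOn_exp_mul_Ioi (a := a - 1) (by linarith) 0).const_mul (lam * d)).mono'
      hcont.aestronglyMeasurable (Eventually.of_forall fun t => ?_)
    rw [norm_of_nonneg (hnn t)]
    refine (hle t).trans ?_
    have e : exp ((a - 1) * t) = exp (a * t) / exp t := by rw [← exp_sub]; ring_nf
    have h1 := exp_pos t
    have h2 := exp_pos (a * t)
    have : lam / (lam + exp t) ≤ lam / exp t := by gcongr; linarith
    rw [e]
    calc _ ≤ lam / exp t * (d * exp (a * t)) := by gcongr
      _ = _ := by ring

/-- Cauchy's formula on the boundary of the slit plane: the Stieltjes representation of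
`exp (-d * lam ^ a)`. -/
lemma exp_neg_rpow_eq (hlam : 0 < lam) (hd : 0 ≤ d) (ha : 0 < a) (ha' : a ≤ 1 / 2) :
    exp (-d * lam ^ a) = 1 - π⁻¹ * ∫ t, lam / (lam + exp t) * jump 0 d a t := by
  have hint : Integrable (fun t => lam / (lam + exp t) * jump 0 d a t) := by
    refine (integrable_cauchyKernel_jump hlam hd ha ha').mono' ?_ (Eventually.of_forall fun t => ?_)
    · exact ((continuous_const.div (by fun_prop) fun t => by have := exp_pos t; positivity).mul
        (continuous_jump 0 d a)).aestronglyMeasurable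
    · have := exp_pos t
      rw [norm_mul, norm_of_nonneg (by positivity), norm_eq_abs]
  have hval : expIntegrand 0 d a (log lam) = ((exp (-d * lam ^ a) : ℝ) : ℂ) := by
    rw [expIntegrand, rpow_def_of_pos hlam]
    push_cast
    ring_nf
  have hrect : ∀ R : ℝ, 2 * (∫ t in -R..R, lam / (lam + exp t) * jump 0 d a t)
      + (∫ θ in -π..π, cauchyKernel lam d a ((R : ℝ) + θ * Complex.I)).re
      - (∫ θ in -π..π, cauchyKernel lam d a ((-R : ℝ) + θ * Complex.I)).re = 0 := by
    intro R
    have h := Complex.integral_boundary_rect_eq_zero_of_differentiableOn (cauchyKernel lam d a)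
      ⟨-R, -π⟩ ⟨R, π⟩ (fun w hw => (differentiableAt_cauchyKernel hlam (by
        have := hw.2
        simp only [mem_preimage, uIcc_of_le (by linarith [pi_pos] : -π ≤ π)] at this
        exact abs_le.2 this)).differentiableWithinAt)
    simp only at h
    have hi : ∀ θ : ℝ, |θ| ≤ π → IntervalIntegrable
        (fun t : ℝ => cauchyKernel lam d a (t + θ * Complex.I)) volume (-R) R := by
      intro θ hθ
      refine ContinuousOn.intervalIntegrable fun t _ => ContinuousAt.continuousWithinAt ?_
      have : ContinuousAt (cauchyKernel lam d a) ((t : ℂ) + θ * Complex.I) :=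
        (differentiableAt_cauchyKernel hlam (by simpa using hθ)).continuousAt
      exact ContinuousAt.comp (f := fun t : ℝ => (t : ℂ) + θ * Complex.I) this (by fun_prop)
    have him := congrArg Complex.im h
    rw [← intervalIntegral.integral_sub (hi _ (by simp [abs_of_pos pi_pos]))
      (hi _ (by simp [abs_of_pos pi_pos]))] at him
    simp only [Complex.sub_im, Complex.add_im, smul_eq_mul, Complex.I_mul_im,
      Complex.zero_im] at him
    have hIm : (∫ t in -R..R, (cauchyKernel lam d a (t + (-π : ℝ) * Complex.I)
        - cauchyKernel lam d a (t + (π : ℝ) * Complex.I))).im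
        = 2 * ∫ t in -R..R, lam / (lam + exp t) * jump 0 d a t := by
      rw [← intervalIntegral.integral_const_mul]
      have := Complex.imCLM.intervalIntegral_comp_comm ((hi (-π) (by simp [abs_of_pos pi_pos])).sub
        (hi π (by simp [abs_of_pos pi_pos])))
      simp only [Complex.imCLM_apply] at this
      rw [← this]
      refine intervalIntegral.integral_congr fun t _ => ?_
      rw [Complex.sub_im]
      exact cauchyKernel_jump hlam t
    rw [hIm] at him
    exact him
  have hl1 : Tendsto (fun R : ℝ => ∫ t in -R..R, lam / (lam + exp t) * jump 0 d a t) atTop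
      (𝓝 (∫ t, lam / (lam + exp t) * jump 0 d a t)) :=
    intervalIntegral_tendsto_integral hint tendsto_neg_atTop_atBot tendsto_id
  have hl2 := (Complex.continuous_re.tendsto _).comp (tendsto_cauchyKernel_right hlam hd ha.le ha')
  have hl3 := (Complex.continuous_re.tendsto _).comp
    ((tendsto_cauchyKernel_left hlam hd ha ha').comp tendsto_neg_atTop_atBot)
  have hlim := ((hl1.const_mul 2).add hl2).sub hl3
  have h0 := tendsto_nhds_unique (hlim.congr fun R => hrect R) tendsto_const_nhds
  rw [hval] at h0
  have hre : (2 * (π : ℂ) * (1 - ((exp (-d * lam ^ a) : ℝ) : ℂ))).re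
      = 2 * π * (1 - exp (-d * lam ^ a)) := by
    rw [show (2 * (π : ℂ) * (1 - ((exp (-d * lam ^ a) : ℝ) : ℂ)))
      = ((2 * π * (1 - exp (-d * lam ^ a)) : ℝ) : ℂ) by push_cast; ring, Complex.ofReal_re]
  rw [hre, Complex.zero_re] at h0
  have hI : ∫ t, lam / (lam + exp t) * jump 0 d a t = π * (1 - exp (-d * lam ^ a)) := by linarith
  rw [hI, inv_mul_cancel_left₀ pi_ne_zero]
  ring

lemma jump_eq_exp_mul (x d a t : ℝ) : jump x d a t = exp (-(x * exp t)) * jump 0 d a t := by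
  rw [jump, jump, ← mul_assoc (exp (-(x * exp t))), ← exp_add]
  ring_nf

/-- Translating the variable amounts to rescaling `c` and `d`. -/
lemma jump_add (c d a t s : ℝ) :
    jump c d a (t + s) = jump (c * exp s) (d * exp (a * s)) a t := by
  rw [jump, jump, mul_add, exp_add, exp_add]
  ring_nf

lemma integral_exp_neg_mul_Ioi_zero {b : ℝ} (hb : 0 < b) :
    ∫ x in Ioi (0 : ℝ), exp (-b * x) = 1 / b := by
  rw [integral_exp_mul_Ioi (neg_lt_zero.2 hb), mul_zero, exp_zero, neg_div_neg_eq]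

/-- Fubini's theorem turns the Stieltjes representation into a Laplace transform. -/
lemma laplace_jump (hlam : 0 < lam) (hd : 0 ≤ d) (ha : 0 < a) (ha' : a ≤ 1 / 2) :
    lam * ∫ x in Ioi (0 : ℝ), exp (-lam * x) * (1 - π⁻¹ * ∫ t, jump x d a t)
      = exp (-d * lam ^ a) := by
  let f : ℝ → ℝ → ℝ := fun x t => lam * (exp (-(lam + exp t) * x) * jump 0 d a t)
  have hcont : Continuous (Function.uncurry f) := by
    have := continuous_jump 0 d a
    simp only [f, Function.uncurry_def]
    fun_prop
  have hinner : ∀ t, ∫ x in Ioi (0 : ℝ), ‖f x t‖ = lam / (lam + exp t) * |jump 0 d a t| := by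
    intro t
    have h0 : 0 < lam + exp t := by have := exp_pos t; positivity
    have : ∀ x, ‖f x t‖ = lam * |jump 0 d a t| * exp (-(lam + exp t) * x) := by
      intro x
      rw [norm_mul, norm_mul, norm_of_nonneg hlam.le, norm_of_nonneg (exp_pos _).le, norm_eq_abs]
      ring
    simp only [this]
    rw [integral_const_mul, integral_exp_neg_mul_Ioi_zero h0]
    ring
  have hint : Integrable (Function.uncurry f) ((volume.restrict (Ioi 0)).prod volume) := by
    rw [integrable_prod_iff' hcont.aestronglyMeasurable]
    constructor
    · refine Eventually.of_forall fun t => ?_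
      have h0 : -(lam + exp t) < 0 := by have := exp_pos t; linarith
      simp only [f, Function.uncurry_apply_pair]
      exact ((integrableOn_exp_mul_Ioi h0 0).mul_const (jump 0 d a t)).const_mul lam
    · simp only [Function.uncurry_apply_pair, hinner]
      exact integrable_cauchyKernel_jump hlam hd ha ha'
  have hfx : ∀ x, ∫ t, f x t = lam * (exp (-lam * x) * ∫ t, jump x d a t) := by
    intro x
    rw [← integral_const_mul, ← integral_const_mul]
    refine integral_congr_ae (Eventually.of_forall fun t => ?_)
    simp only [f]
    rw [jump_eq_exp_mul x, ← mul_assoc (exp _), ← exp_add]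
    ring_nf
  have hft : ∀ t, ∫ x in Ioi (0 : ℝ), f x t = lam / (lam + exp t) * jump 0 d a t := by
    intro t
    have h0 : 0 < lam + exp t := by have := exp_pos t; positivity
    rw [integral_const_mul, integral_mul_const, integral_exp_neg_mul_Ioi_zero h0]
    ring
  have hswap := integral_integral_swap hint
  simp only [hfx, hft] at hswap
  have hi1 := integrableOn_exp_mul_Ioi (neg_lt_zero.2 hlam) 0
  have hi2 : IntegrableOn (fun x => π⁻¹ * (lam⁻¹ * ∫ t, f x t)) (Ioi 0) :=
    (hint.integral_prod_left.const_mul _).const_mul _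
  have hsplit : ∀ x, exp (-lam * x) * (1 - π⁻¹ * ∫ t, jump x d a t)
      = exp (-lam * x) - π⁻¹ * (lam⁻¹ * ∫ t, f x t) := by
    intro x
    rw [hfx]
    field_simp
  simp only [hsplit]
  rw [integral_sub hi1 hi2, integral_exp_neg_mul_Ioi_zero hlam, integral_const_mul,
    integral_const_mul]
  simp only [hfx]
  rw [hswap, exp_neg_rpow_eq hlam hd ha ha']
  field_simp

/-- The integral over the steepest descent path, rescaled to the exponent
`x * z - γ * z ^ idx γ`. -/
lemma integral_exp_phase_eq {γ : ℝ} (h1 : 1 < γ) (h2 : γ ≤ 2) {x : ℝ} (hx : 0 < x) :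
    π⁻¹ * ∫ φ in Ioo 0 π, exp (-((x / (γ - 1)) ^ (-(γ - 1)) * phase γ φ))
      = 1 - π⁻¹ * ∫ t, jump x γ (idx γ) t := by
  have hγ : 0 < γ - 1 := by linarith
  have hx' : 0 < x / (γ - 1) := by positivity
  rw [integral_exp_phase h1 h2 (rpow_pos_of_pos hx' _)]
  have hs : ∀ t, jump ((x / (γ - 1)) ^ (-(γ - 1)) * (γ - 1)) ((x / (γ - 1)) ^ (-(γ - 1)) * γ)
      (idx γ) t = jump x γ (idx γ) (t + -γ * log (x / (γ - 1))) := by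
    intro t
    rw [jump_add]
    have hg := gamma_mul_idx h1
    congr 1
    · have e : exp (-γ * log (x / (γ - 1))) = (x / (γ - 1)) ^ (-(γ - 1)) / (x / (γ - 1)) := by
        rw [rpow_def_of_pos hx', ← exp_log hx', ← exp_sub, log_exp]
        ring_nf
      rw [e]
      field_simp
    · rw [rpow_def_of_pos hx', mul_comm γ, ← hg]
      ring_nf
  simp only [hs]
  rw [integral_add_right_eq_self (fun t => jump x γ (idx γ) t), mul_sub,
    inv_mul_cancel₀ pi_ne_zero]

end Kernel

/-! ### The stable density, its derivative and their Laplace transforms -/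

/-- The `j`-th moment of `phase γ` against `exp (-y * phase γ)` over the upper half of the steepest
descent path. -/
noncomputable def phaseLaplace (γ : ℝ) (j : ℕ) (y : ℝ) : ℝ :=
  ∫ φ in Ioo 0 π, phase γ φ ^ j * exp (-(y * phase γ φ))

section PhaseLaplace

variable {γ : ℝ}

lemma phase_pow_mul_exp_le (h1 : 1 < γ) (h2 : γ ≤ 2) (j : ℕ) {y φ : ℝ} (hy : 0 < y)
    (hφ : φ ∈ Ioo 0 π) : phase γ φ ^ j * exp (-(y * phase γ φ))
      ≤ j.factorial * (y / 2)⁻¹ ^ j * exp (-(y / 2)) := by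
  have hA := one_lt_phase h1 h2 hφ.1 hφ.2
  have e : exp (-(y * phase γ φ)) = exp (-(y / 2 * phase γ φ)) * exp (-(y / 2 * phase γ φ)) := by
    rw [← exp_add]; ring_nf
  rw [e, ← mul_assoc]
  have i1 := pow_mul_exp_neg_le j (by linarith : 0 ≤ phase γ φ) (half_pos hy)
  have i2 : exp (-(y / 2 * phase γ φ)) ≤ exp (-(y / 2)) := by
    apply exp_le_exp.2
    nlinarith
  gcongr

lemma aestronglyMeasurable_phaseLaplace (j : ℕ) (y : ℝ) (μ : Measure ℝ) :
    AEStronglyMeasurable (fun φ => phase γ φ ^ j * exp (-(y * phase γ φ))) μ := by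
  have := measurable_phase γ
  exact Measurable.aestronglyMeasurable (by fun_prop)

lemma integrableOn_phaseLaplace (h1 : 1 < γ) (h2 : γ ≤ 2) (j : ℕ) {y : ℝ} (hy : 0 < y) :
    IntegrableOn (fun φ => phase γ φ ^ j * exp (-(y * phase γ φ))) (Ioo 0 π) := by
  refine Measure.integrableOn_of_bounded (M := j.factorial * (y / 2)⁻¹ ^ j * exp (-(y / 2)))
    (by simp) (aestronglyMeasurable_phaseLaplace j y _) ?_
  filter_upwards [ae_restrict_mem measurableSet_Ioo] with φ hφ
  have hA := one_lt_phase h1 h2 hφ.1 hφ.2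
  rw [norm_of_nonneg (by positivity)]
  exact phase_pow_mul_exp_le h1 h2 j hy hφ

lemma phaseLaplace_pos (h1 : 1 < γ) (h2 : γ ≤ 2) (j : ℕ) {y : ℝ} (hy : 0 < y) :
    0 < phaseLaplace γ j y := by
  have hpos : ∀ φ ∈ Ioo 0 π, 0 < phase γ φ ^ j * exp (-(y * phase γ φ)) := fun φ hφ => by
    have := one_lt_phase h1 h2 hφ.1 hφ.2
    positivity
  rw [phaseLaplace, setIntegral_pos_iff_support_of_nonneg_ae]
  · have : Ioo 0 π ⊆ Function.support fun φ => phase γ φ ^ j * exp (-(y * phase γ φ)) :=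
      fun φ hφ => (hpos φ hφ).ne'
    rw [inter_eq_right.2 this]
    simp [pi_pos]
  · filter_upwards [ae_restrict_mem measurableSet_Ioo] with φ hφ using (hpos φ hφ).le
  · exact integrableOn_phaseLaplace h1 h2 j hy

lemma phaseLaplace_le (h1 : 1 < γ) (h2 : γ ≤ 2) (j : ℕ) {y : ℝ} (hy : 0 < y) :
    phaseLaplace γ j y ≤ π * (j.factorial * (y / 2)⁻¹ ^ j * exp (-(y / 2))) := by
  have : ∫ φ in Ioo 0 π, j.factorial * (y / 2)⁻¹ ^ j * exp (-(y / 2))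
      = π * (j.factorial * (y / 2)⁻¹ ^ j * exp (-(y / 2))) := by
    rw [setIntegral_const]
    simp [pi_pos.le]
  rw [← this]
  exact setIntegral_mono_on (integrableOn_phaseLaplace h1 h2 j hy) (integrableOn_const (by simp))
    measurableSet_Ioo fun φ hφ => phase_pow_mul_exp_le h1 h2 j hy hφ

lemma hasDerivAt_phaseLaplace (h1 : 1 < γ) (h2 : γ ≤ 2) (j : ℕ) {y : ℝ} (hy : 0 < y) :
    HasDerivAt (phaseLaplace γ j) (-phaseLaplace γ (j + 1) y) y := by
  have h := hasDerivAt_integral_of_dominated_loc_of_deriv_le (μ := volume.restrict (Ioo 0 π))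
    (F := fun y φ => phase γ φ ^ j * exp (-(y * phase γ φ)))
    (F' := fun y φ => -(phase γ φ ^ (j + 1) * exp (-(y * phase γ φ))))
    (bound := fun φ => (j + 1).factorial * (y / 2 / 2)⁻¹ ^ (j + 1)) (Ioi_mem_nhds (half_lt_self hy))
    (Eventually.of_forall fun y => aestronglyMeasurable_phaseLaplace j y _)
    (integrableOn_phaseLaplace h1 h2 j hy)
    (aestronglyMeasurable_phaseLaplace (j + 1) y _).neg ?_ (integrableOn_const (by simp)) ?_
  · rw [phaseLaplace, ← integral_neg]
    exact h.2
  · filter_upwards [ae_restrict_mem measurableSet_Ioo] with φ hφ z hz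
    have hA := one_lt_phase h1 h2 hφ.1 hφ.2
    have hz : y / 2 < z := hz
    have hz0 : 0 < z := (half_pos hy).trans hz
    rw [norm_neg, norm_of_nonneg (by positivity)]
    refine (phase_pow_mul_exp_le h1 h2 (j + 1) hz0 hφ).trans ?_
    have i1 : exp (-(z / 2)) ≤ 1 := exp_le_one_iff.2 (by linarith)
    calc _ ≤ (j + 1).factorial * (z / 2)⁻¹ ^ (j + 1) * 1 := by gcongr
      _ ≤ _ := by rw [mul_one]; gcongr
  · refine Eventually.of_forall fun φ z _ => ?_
    have : HasDerivAt (fun z : ℝ => -(z * phase γ φ)) (-(1 * phase γ φ)) z :=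
      ((hasDerivAt_id z).mul_const (phase γ φ)).neg
    refine (this.exp.const_mul (phase γ φ ^ j)).congr_deriv ?_
    ring

lemma tendsto_phaseLaplace_zero (h1 : 1 < γ) (h2 : γ ≤ 2) :
    Tendsto (phaseLaplace γ 0) (𝓝[>] 0) (𝓝 π) := by
  have e : ∫ _φ in Ioo 0 π, (1 : ℝ) = π := by simp [pi_pos.le]
  suffices Tendsto (phaseLaplace γ 0) (𝓝[>] 0) (𝓝 (∫ _φ in Ioo 0 π, (1 : ℝ))) by rwa [e] at this
  refine tendsto_integral_filter_of_dominated_convergence (fun _ => 1)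
    (Eventually.of_forall fun y => aestronglyMeasurable_phaseLaplace 0 y _) ?_
    (integrableOn_const (by simp)) ?_
  · filter_upwards [self_mem_nhdsWithin] with y hy
    filter_upwards [ae_restrict_mem measurableSet_Ioo] with φ hφ
    have hA := one_lt_phase h1 h2 hφ.1 hφ.2
    have hy : 0 < y := hy
    rw [norm_of_nonneg (by positivity), pow_zero, one_mul, exp_le_one_iff]
    nlinarith
  · refine Eventually.of_forall fun φ => ?_
    have : Tendsto (fun y => phase γ φ ^ 0 * exp (-(y * phase γ φ))) (𝓝 0)
        (𝓝 (phase γ φ ^ 0 * exp (-(0 * phase γ φ)))) := Continuous.tendsto (by fun_prop) 0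
    simp only [pow_zero, zero_mul, neg_zero, exp_zero, mul_one] at this ⊢
    exact this.mono_left nhdsWithin_le_nhds

end PhaseLaplace

/-- The distribution function of the stable law. -/
noncomputable def stableCdf (γ x : ℝ) : ℝ :=
  if x ≤ 0 then 0 else π⁻¹ * phaseLaplace γ 0 ((x / (γ - 1)) ^ (-(γ - 1)))

/-- The density of the stable law. -/
noncomputable def stableDensity (γ x : ℝ) : ℝ :=
  if x ≤ 0 then 0 else
    π⁻¹ * ((x / (γ - 1)) ^ (-γ) * phaseLaplace γ 1 ((x / (γ - 1)) ^ (-(γ - 1))))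

/-- The derivative of the density of the stable law. -/
noncomputable def stableDensityDeriv (γ x : ℝ) : ℝ :=
  if x ≤ 0 then 0 else
    π⁻¹ * ((x / (γ - 1)) ^ (-γ) * (x / (γ - 1)) ^ (-γ) *
        phaseLaplace γ 2 ((x / (γ - 1)) ^ (-(γ - 1)))
      - γ / (γ - 1) * (x / (γ - 1)) ^ (-γ - 1) * phaseLaplace γ 1 ((x / (γ - 1)) ^ (-(γ - 1))))

section Density

variable {γ : ℝ}

lemma hasDerivAt_scaled_rpow (h1 : 1 < γ) {x : ℝ} (hx : 0 < x) (p : ℝ) :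
    HasDerivAt (fun x : ℝ => (x / (γ - 1)) ^ p) (p / (γ - 1) * (x / (γ - 1)) ^ (p - 1)) x := by
  have hγ : 0 < γ - 1 := by linarith
  refine (((hasDerivAt_id x).div_const (γ - 1)).rpow_const (p := p)
    (Or.inl (div_pos hx hγ).ne')).congr_deriv ?_
  simp only [id]
  ring

lemma hasDerivAt_scaled (h1 : 1 < γ) {x : ℝ} (hx : 0 < x) :
    HasDerivAt (fun x : ℝ => (x / (γ - 1)) ^ (-(γ - 1))) (-(x / (γ - 1)) ^ (-γ)) x := by
  have hγ : γ - 1 ≠ 0 := by linarith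
  refine (hasDerivAt_scaled_rpow h1 hx _).congr_deriv ?_
  rw [neg_div, div_self hγ, show -(γ - 1) - 1 = -γ by ring]
  ring

lemma hasDerivAt_stableCdf (h1 : 1 < γ) (h2 : γ ≤ 2) {x : ℝ} (hx : 0 < x) :
    HasDerivAt (stableCdf γ) (stableDensity γ x) x := by
  have hx' : 0 < x / (γ - 1) := div_pos hx (by linarith)
  have h := ((hasDerivAt_phaseLaplace h1 h2 0 (rpow_pos_of_pos hx' (-(γ - 1)))).comp x
    (hasDerivAt_scaled h1 hx)).const_mul π⁻¹
  rw [stableDensity, if_neg hx.not_ge]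
  refine (h.congr_of_eventuallyEq ?_).congr_deriv (by ring)
  filter_upwards [Ioi_mem_nhds hx] with z hz
  rw [stableCdf, if_neg (not_le.2 hz)]
  rfl

lemma hasDerivAt_stableDensity_of_pos (h1 : 1 < γ) (h2 : γ ≤ 2) {x : ℝ} (hx : 0 < x) :
    HasDerivAt (stableDensity γ) (stableDensityDeriv γ x) x := by
  have hx' : 0 < x / (γ - 1) := div_pos hx (by linarith)
  have h := ((hasDerivAt_scaled_rpow h1 hx (-γ)).mul
    ((hasDerivAt_phaseLaplace h1 h2 1 (rpow_pos_of_pos hx' (-(γ - 1)))).comp x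
    (hasDerivAt_scaled h1 hx))).const_mul π⁻¹
  rw [stableDensityDeriv, if_neg hx.not_ge]
  refine (h.congr_of_eventuallyEq ?_).congr_deriv (by simp only [Function.comp_apply]; ring)
  filter_upwards [Ioi_mem_nhds hx] with z hz
  rw [stableDensity, if_neg (not_le.2 hz)]
  rfl

lemma stableDensity_of_nonpos {x : ℝ} (hx : x ≤ 0) : stableDensity γ x = 0 := if_pos hx

lemma stableDensity_pos (h1 : 1 < γ) (h2 : γ ≤ 2) {x : ℝ} (hx : 0 < x) :
    0 < stableDensity γ x := by
  have hx' : 0 < x / (γ - 1) := div_pos hx (by linarith)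
  have := phaseLaplace_pos h1 h2 1 (rpow_pos_of_pos hx' (-(γ - 1)))
  have := pi_pos
  rw [stableDensity, if_neg hx.not_ge]
  positivity

/-- The bound behind the flatness at `0` and the decay at `∞` of the distribution function, the
density and its derivative (`j = 0, 1, 2`), with `z = x / (γ - 1)`. -/
lemma phaseLaplace_scaled_le (h1 : 1 < γ) (h2 : γ ≤ 2) (j : ℕ) {z : ℝ} (hz : 0 < z) :
    π⁻¹ * ((z ^ (-γ)) ^ j * phaseLaplace γ j (z ^ (-(γ - 1))))
      ≤ 2 ^ j * j.factorial * (z⁻¹ ^ j * exp (-(z ^ (-(γ - 1)) / 2))) := by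
  have hy := rpow_pos_of_pos hz (-(γ - 1))
  have h := phaseLaplace_le h1 h2 j hy
  have hπ := pi_pos
  have e : z ^ (-γ) * (z ^ (-(γ - 1)))⁻¹ = z⁻¹ := by
    rw [← rpow_neg hz.le, ← rpow_add hz, show -γ + - -(γ - 1) = -1 by ring, rpow_neg_one]
  calc _ ≤ π⁻¹ * ((z ^ (-γ)) ^ j * (π * (j.factorial * (z ^ (-(γ - 1)) / 2)⁻¹ ^ j *
        exp (-(z ^ (-(γ - 1)) / 2))))) := by gcongr
    _ = 2 ^ j * j.factorial *
        ((z ^ (-γ) * (z ^ (-(γ - 1)))⁻¹) ^ j * exp (-(z ^ (-(γ - 1)) / 2))) := by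
        rw [inv_div, div_pow, mul_pow, inv_pow]
        field_simp
    _ = _ := by rw [e]

lemma abs_stableCdf_le (h1 : 1 < γ) (h2 : γ ≤ 2) {x : ℝ} (hx : 0 < x) :
    |stableCdf γ x| ≤ 1 * ((x / (γ - 1))⁻¹ ^ 0 * exp (-((x / (γ - 1)) ^ (-(γ - 1)) / 2))) := by
  have hx' : 0 < x / (γ - 1) := div_pos hx (by linarith)
  have h := phaseLaplace_scaled_le h1 h2 0 hx'
  have := phaseLaplace_pos h1 h2 0 (rpow_pos_of_pos hx' (-(γ - 1)))
  have := pi_pos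
  rw [stableCdf, if_neg hx.not_ge, abs_of_pos (by positivity)]
  simpa using h

lemma abs_stableDensity_le (h1 : 1 < γ) (h2 : γ ≤ 2) {x : ℝ} (hx : 0 < x) :
    |stableDensity γ x| ≤ 2 * ((x / (γ - 1))⁻¹ ^ 1 * exp (-((x / (γ - 1)) ^ (-(γ - 1)) / 2))) := by
  have hx' : 0 < x / (γ - 1) := div_pos hx (by linarith)
  have h := phaseLaplace_scaled_le h1 h2 1 hx'
  rw [abs_of_pos (stableDensity_pos h1 h2 hx), stableDensity, if_neg hx.not_ge]
  simpa using h

lemma abs_stableDensityDeriv_le (h1 : 1 < γ) (h2 : γ ≤ 2) {x : ℝ} (hx : 0 < x) :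
    |stableDensityDeriv γ x| ≤ (8 + 2 * (γ / (γ - 1))) *
      ((x / (γ - 1))⁻¹ ^ 2 * exp (-((x / (γ - 1)) ^ (-(γ - 1)) / 2))) := by
  have hγ : 0 < γ - 1 := by linarith
  have hx' : 0 < x / (γ - 1) := div_pos hx hγ
  rw [stableDensityDeriv, if_neg hx.not_ge]
  generalize x / (γ - 1) = z at *
  have e1 := phaseLaplace_scaled_le h1 h2 1 hx'
  have e2 := phaseLaplace_scaled_le h1 h2 2 hx'
  have p1 := phaseLaplace_pos h1 h2 1 (rpow_pos_of_pos hx' (-(γ - 1)))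
  have p2 := phaseLaplace_pos h1 h2 2 (rpow_pos_of_pos hx' (-(γ - 1)))
  have hπ := pi_pos
  have hz : z ^ (-γ - 1) = z ^ (-γ) * z⁻¹ := by rw [rpow_sub hx', rpow_one, div_eq_mul_inv]
  have hr := rpow_pos_of_pos hx' (-γ)
  have hq : 0 < γ / (γ - 1) := by positivity
  have hzi : 0 < z⁻¹ := by positivity
  have e3 := mul_le_mul_of_nonneg_left e1 (mul_pos hq hzi).le
  simp only [pow_one, Nat.factorial_one, Nat.cast_one, mul_one, Nat.factorial_two, Nat.cast_ofNat]
    at e1 e2 e3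
  rw [hz, abs_le]
  constructor
  · have : 0 < π⁻¹ * (z ^ (-γ) * z ^ (-γ) * phaseLaplace γ 2 (z ^ (-(γ - 1)))) := by positivity
    have h8 : 0 ≤ 8 * (z⁻¹ ^ 2 * exp (-(z ^ (-(γ - 1)) / 2))) := by positivity
    linarith
  · have : 0 < π⁻¹ * (γ / (γ - 1) * (z ^ (-γ) * z⁻¹) * phaseLaplace γ 1 (z ^ (-(γ - 1)))) := by
      positivity
    have h8 : 0 ≤ 2 * (γ / (γ - 1)) * (z⁻¹ ^ 2 * exp (-(z ^ (-(γ - 1)) / 2))) := by positivity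
    linarith

lemma tendsto_bound_zero (h1 : 1 < γ) (m : ℕ) :
    Tendsto (fun x : ℝ => (x / (γ - 1))⁻¹ ^ m * exp (-((x / (γ - 1)) ^ (-(γ - 1)) / 2))) (𝓝[>] 0)
      (𝓝 0) := by
  have hγ : 0 < γ - 1 := by linarith
  have hz : Tendsto (fun x : ℝ => x / (γ - 1)) (𝓝[>] 0) (𝓝[>] 0) := by
    refine tendsto_nhdsWithin_iff.2 ⟨?_, ?_⟩
    · have : Tendsto (fun x : ℝ => x / (γ - 1)) (𝓝 0) (𝓝 (0 / (γ - 1))) :=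
        Continuous.tendsto (by fun_prop) 0
      rw [zero_div] at this
      exact this.mono_left nhdsWithin_le_nhds
    · filter_upwards [self_mem_nhdsWithin] with x hx using div_pos hx hγ
  have hy := (tendsto_rpow_atTop hγ).comp (tendsto_inv_nhdsGT_zero.comp hz)
  have := (tendsto_rpow_mul_exp_neg_mul_atTop_nhds_zero (m / (γ - 1)) (1 / 2) (by norm_num)).comp hy
  refine this.congr' ?_
  filter_upwards [self_mem_nhdsWithin] with x hx
  have hx' : 0 < x / (γ - 1) := div_pos hx hγ
  simp only [Function.comp_apply]
  rw [← rpow_mul (by positivity), mul_div_cancel₀ _ hγ.ne', rpow_natCast, inv_rpow hx'.le,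
    ← rpow_neg hx'.le]
  ring_nf

lemma continuousAt_zero_of_le (h1 : 1 < γ) {f : ℝ → ℝ} (m : ℕ) (C : ℝ) (hf0 : ∀ x ≤ 0, f x = 0)
    (hf : ∀ x, 0 < x → |f x| ≤
      C * ((x / (γ - 1))⁻¹ ^ m * exp (-((x / (γ - 1)) ^ (-(γ - 1)) / 2)))) :
    ContinuousAt f 0 := by
  rw [continuousAt_iff_continuous_left'_right']
  constructor
  · refine tendsto_const_nhds.congr' ?_
    filter_upwards [self_mem_nhdsWithin] with x hx
    rw [hf0 x (le_of_lt hx), hf0 0 le_rfl]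
  · rw [ContinuousWithinAt, hf0 0 le_rfl]
    have := (tendsto_bound_zero h1 m).const_mul C
    rw [mul_zero] at this
    refine squeeze_zero_norm' ?_ this
    filter_upwards [self_mem_nhdsWithin] with x hx using hf x hx

lemma tendsto_atTop_zero_of_le (h1 : 1 < γ) {f : ℝ → ℝ} {m : ℕ} (hm : m ≠ 0) {C : ℝ} (hC : 0 ≤ C)
    (hf : ∀ x, 0 < x → |f x| ≤
      C * ((x / (γ - 1))⁻¹ ^ m * exp (-((x / (γ - 1)) ^ (-(γ - 1)) / 2)))) :
    Tendsto f atTop (𝓝 0) := by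
  have hγ : 0 < γ - 1 := by linarith
  have h0 : Tendsto (fun x : ℝ => C * ((x / (γ - 1))⁻¹ ^ m)) atTop (𝓝 0) := by
    have := ((tendsto_inv_atTop_zero.comp (tendsto_id.atTop_div_const hγ)).pow m).const_mul C
    simpa [hm] using this
  refine squeeze_zero_norm' ?_ h0
  filter_upwards [eventually_gt_atTop 0] with x hx
  have hx' : 0 < x / (γ - 1) := div_pos hx hγ
  refine (hf x hx).trans ?_
  have : exp (-((x / (γ - 1)) ^ (-(γ - 1)) / 2)) ≤ 1 := by
    rw [exp_le_one_iff]
    have := rpow_pos_of_pos hx' (-(γ - 1))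
    linarith
  have h2 : 0 ≤ (x / (γ - 1))⁻¹ ^ m := by positivity
  exact mul_le_mul_of_nonneg_left (by nlinarith) hC

lemma continuous_stableCdf (h1 : 1 < γ) (h2 : γ ≤ 2) : Continuous (stableCdf γ) := by
  refine continuous_iff_continuousAt.2 fun x => ?_
  rcases lt_trichotomy x 0 with hx | rfl | hx
  · refine (continuousAt_const (y := (0 : ℝ))).congr ?_
    filter_upwards [Iio_mem_nhds hx] with z hz
    exact (if_pos (le_of_lt hz)).symm
  · exact continuousAt_zero_of_le h1 0 1 (fun _ hx => if_pos hx)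
      fun x hx => abs_stableCdf_le h1 h2 hx
  · exact (hasDerivAt_stableCdf h1 h2 hx).continuousAt

lemma hasDerivAt_stableDensity_of_neg {x : ℝ} (hx : x < 0) :
    HasDerivAt (stableDensity γ) (stableDensityDeriv γ x) x := by
  rw [stableDensityDeriv, if_pos hx.le]
  refine (hasDerivAt_const x (0 : ℝ)).congr_of_eventuallyEq ?_
  filter_upwards [Iio_mem_nhds hx] with z hz
  exact stableDensity_of_nonpos (le_of_lt hz)

lemma continuous_stableDensity (h1 : 1 < γ) (h2 : γ ≤ 2) : Continuous (stableDensity γ) := by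
  refine continuous_iff_continuousAt.2 fun x => ?_
  rcases lt_trichotomy x 0 with hx | rfl | hx
  · exact (hasDerivAt_stableDensity_of_neg hx).continuousAt
  · exact continuousAt_zero_of_le h1 1 2 (fun _ hx => if_pos hx)
      fun x hx => abs_stableDensity_le h1 h2 hx
  · exact (hasDerivAt_stableDensity_of_pos h1 h2 hx).continuousAt

lemma continuous_stableDensityDeriv (h1 : 1 < γ) (h2 : γ ≤ 2) :
    Continuous (stableDensityDeriv γ) := by
  refine continuous_iff_continuousAt.2 fun x => ?_
  rcases lt_trichotomy x 0 with hx | rfl | hx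
  · refine (continuousAt_const (y := (0 : ℝ))).congr ?_
    filter_upwards [Iio_mem_nhds hx] with z hz
    exact (if_pos (le_of_lt hz)).symm
  · exact continuousAt_zero_of_le h1 2 _ (fun _ hx => if_pos hx)
      fun x hx => abs_stableDensityDeriv_le h1 h2 hx
  · have hx' : 0 < x / (γ - 1) := div_pos hx (by linarith)
    have hr : ∀ p : ℝ, ContinuousAt (fun x : ℝ => (x / (γ - 1)) ^ p) x := fun p =>
      (hasDerivAt_scaled_rpow h1 hx p).continuousAt
    have hK : ∀ j, ContinuousAt (fun x : ℝ => phaseLaplace γ j ((x / (γ - 1)) ^ (-(γ - 1)))) x :=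
      fun j => ContinuousAt.comp (f := fun x : ℝ => (x / (γ - 1)) ^ (-(γ - 1)))
        (hasDerivAt_phaseLaplace h1 h2 j (rpow_pos_of_pos hx' _)).continuousAt (hr _)
    have := continuousAt_const (y := π⁻¹).mul (((((hr (-γ)).mul (hr (-γ))).mul (hK 2))).sub
      ((continuousAt_const (y := γ / (γ - 1)).mul (hr (-γ - 1))).mul (hK 1)))
    refine this.congr ?_
    filter_upwards [Ioi_mem_nhds hx] with z hz
    exact (if_neg (not_le.2 hz)).symm

lemma hasDerivAt_stableDensity (h1 : 1 < γ) (h2 : γ ≤ 2) (x : ℝ) :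
    HasDerivAt (stableDensity γ) (stableDensityDeriv γ x) x := by
  have hne : ∀ z ≠ 0, HasDerivAt (stableDensity γ) (stableDensityDeriv γ z) z := by
    intro z hz
    rcases lt_or_gt_of_ne hz with hz | hz
    · exact hasDerivAt_stableDensity_of_neg hz
    · exact hasDerivAt_stableDensity_of_pos h1 h2 hz
  rcases eq_or_ne x 0 with rfl | hx
  · exact hasDerivAt_of_hasDerivAt_of_ne hne (continuous_stableDensity h1 h2).continuousAt
      (continuous_stableDensityDeriv h1 h2).continuousAt
  · exact hne x hx

lemma deriv_stableDensity (h1 : 1 < γ) (h2 : γ ≤ 2) :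
    deriv (stableDensity γ) = stableDensityDeriv γ :=
  funext fun x => (hasDerivAt_stableDensity h1 h2 x).deriv

lemma contDiff_stableDensity (h1 : 1 < γ) (h2 : γ ≤ 2) : ContDiff ℝ 1 (stableDensity γ) := by
  rw [contDiff_one_iff_deriv, deriv_stableDensity h1 h2]
  exact ⟨fun x => (hasDerivAt_stableDensity h1 h2 x).differentiableAt,
    continuous_stableDensityDeriv h1 h2⟩

lemma tendsto_stableCdf (h1 : 1 < γ) (h2 : γ ≤ 2) : Tendsto (stableCdf γ) atTop (𝓝 1) := by
  have hγ : 0 < γ - 1 := by linarith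
  have hy : Tendsto (fun x : ℝ => (x / (γ - 1)) ^ (-(γ - 1))) atTop (𝓝[>] 0) := by
    refine tendsto_nhdsWithin_iff.2 ⟨?_, ?_⟩
    · exact (tendsto_rpow_neg_atTop hγ).comp (tendsto_id.atTop_div_const hγ)
    · filter_upwards [eventually_gt_atTop 0] with x hx
      exact rpow_pos_of_pos (div_pos hx hγ) _
  have := ((tendsto_phaseLaplace_zero h1 h2).comp hy).const_mul π⁻¹
  rw [inv_mul_cancel₀ pi_ne_zero] at this
  refine this.congr' ?_
  filter_upwards [eventually_gt_atTop 0] with x hx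
  rw [stableCdf, if_neg hx.not_ge]
  rfl

lemma tendsto_stableDensity (h1 : 1 < γ) (h2 : γ ≤ 2) : Tendsto (stableDensity γ) atTop (𝓝 0) :=
  tendsto_atTop_zero_of_le h1 one_ne_zero two_pos.le fun _ hx => abs_stableDensity_le h1 h2 hx

lemma integrableOn_stableDensity (h1 : 1 < γ) (h2 : γ ≤ 2) :
    IntegrableOn (stableDensity γ) (Ioi 0) :=
  integrableOn_Ioi_deriv_of_nonneg (continuous_stableCdf h1 h2).continuousWithinAt
    (fun _ hx => hasDerivAt_stableCdf h1 h2 hx) (fun _ hx => (stableDensity_pos h1 h2 hx).le)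
    (tendsto_stableCdf h1 h2)

lemma integrableOn_stableDensityDeriv (h1 : 1 < γ) (h2 : γ ≤ 2) :
    IntegrableOn (stableDensityDeriv γ) (Ioi 0) := by
  have hγ : 0 < γ - 1 := by linarith
  have hc := continuous_stableDensityDeriv h1 h2
  rw [← Ioc_union_Ioi_eq_Ioi zero_le_one, integrableOn_union]
  constructor
  · exact (hc.integrableOn_Icc (a := 0) (b := 1)).mono_set Ioc_subset_Icc_self
  · refine ((integrableOn_Ioi_rpow_of_lt (by norm_num : (-2 : ℝ) < -1) one_pos).const_mul
      ((8 + 2 * (γ / (γ - 1))) * (γ - 1) ^ 2)).mono' hc.aestronglyMeasurable ?_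
    filter_upwards [ae_restrict_mem measurableSet_Ioi] with x hx
    have hx : 1 < x := hx
    have hx0 : 0 < x := by linarith
    have hx' : 0 < x / (γ - 1) := div_pos hx0 hγ
    refine (abs_stableDensityDeriv_le h1 h2 hx0).trans ?_
    have : exp (-((x / (γ - 1)) ^ (-(γ - 1)) / 2)) ≤ 1 := by
      rw [exp_le_one_iff]
      have := rpow_pos_of_pos hx' (-(γ - 1))
      linarith
    have hq : 0 < γ / (γ - 1) := by positivity
    calc _ ≤ (8 + 2 * (γ / (γ - 1))) * ((x / (γ - 1))⁻¹ ^ 2 * 1) := by gcongr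
      _ = _ := by
        rw [rpow_neg hx0.le, rpow_two, inv_div, div_pow]
        field_simp

/-- Integration by parts for the Laplace transform of a derivative. -/
lemma laplace_deriv {f f' : ℝ → ℝ} {m lam : ℝ} (hlam : 0 < lam) (hf0 : f 0 = 0)
    (hc : Continuous f) (hder : ∀ x, 0 < x → HasDerivAt f (f' x) x)
    (hint : IntegrableOn f' (Ioi 0)) (hlim : Tendsto f atTop (𝓝 m))
    (hfint : IntegrableOn (fun x => exp (-lam * x) * f x) (Ioi 0)) :
    ∫ x in Ioi (0 : ℝ), exp (-lam * x) * f' x = lam * ∫ x in Ioi (0 : ℝ), exp (-lam * x) * f x := by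
  have hexp : ∀ x : ℝ, HasDerivAt (fun x : ℝ => exp (-lam * x)) (exp (-lam * x) * -lam) x := by
    intro x
    simpa using ((hasDerivAt_id x).const_mul (-lam)).exp
  have hint' : IntegrableOn (fun x => exp (-lam * x) * f' x) (Ioi 0) := by
    refine hint.norm.mono' ?_ ?_
    · exact (Continuous.aestronglyMeasurable (by fun_prop)).mul hint.aestronglyMeasurable
    · filter_upwards [ae_restrict_mem measurableSet_Ioi] with x hx
      have hx : 0 < x := hx
      rw [norm_mul, norm_of_nonneg (exp_pos _).le]
      have : exp (-lam * x) ≤ 1 := by rw [exp_le_one_iff]; nlinarith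
      nlinarith [norm_nonneg (f' x)]
  have hlim' : Tendsto (fun x => exp (-lam * x) * f x) atTop (𝓝 0) := by
    have : Tendsto (fun x : ℝ => exp (-lam * x)) atTop (𝓝 0) :=
      tendsto_exp_atBot.comp (tendsto_id.const_mul_atTop_of_neg (neg_lt_zero.2 hlam))
    simpa using this.mul hlim
  have h := integral_Ioi_of_hasDerivAt_of_tendsto (f := fun x => exp (-lam * x) * f x)
    (f' := fun x => exp (-lam * x) * -lam * f x + exp (-lam * x) * f' x)
    (by fun_prop) (fun x hx => (hexp x).mul (hder x hx)) ?_ hlim'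
  · have e : ∀ x, exp (-lam * x) * -lam * f x = -lam * (exp (-lam * x) * f x) := fun x => by ring
    simp only [e] at h
    rw [integral_add (hfint.const_mul _) hint', integral_const_mul, hf0] at h
    linarith
  · refine IntegrableOn.add ?_ hint'
    refine (hfint.const_mul (-lam)).congr (Eventually.of_forall fun x => ?_)
    simp only
    ring

lemma laplace_stableDensity (h1 : 1 < γ) (h2 : γ ≤ 2) {lam : ℝ} (hlam : 0 ≤ lam) :
    ∫ x in Ioi (0 : ℝ), exp (-lam * x) * stableDensity γ x = exp (-γ * lam ^ idx γ) := by
  rcases hlam.eq_or_lt with rfl | hlam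
  · rw [zero_rpow (idx_pos h1).ne', mul_zero, exp_zero]
    simp only [neg_zero, zero_mul, exp_zero, one_mul]
    rw [integral_Ioi_of_hasDerivAt_of_nonneg (continuous_stableCdf h1 h2).continuousWithinAt
      (fun _ hx => hasDerivAt_stableCdf h1 h2 hx) (fun _ hx => (stableDensity_pos h1 h2 hx).le)
      (tendsto_stableCdf h1 h2), stableCdf, if_pos le_rfl, sub_zero]
  · rw [laplace_deriv (f := stableCdf γ) hlam (if_pos le_rfl) (continuous_stableCdf h1 h2)
      (fun _ hx => hasDerivAt_stableCdf h1 h2 hx) (integrableOn_stableDensity h1 h2)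
      (tendsto_stableCdf h1 h2),
      ← laplace_jump hlam (by linarith : 0 ≤ γ) (idx_pos h1) (idx_le_half h1 h2)]
    · congr 1
      refine setIntegral_congr_fun measurableSet_Ioi fun x hx => ?_
      rw [← integral_exp_phase_eq h1 h2 hx, stableCdf, if_neg (not_le.2 hx), phaseLaplace]
      simp only [pow_zero, one_mul]
    · have hc := continuous_stableCdf h1 h2
      refine (integrableOn_exp_mul_Ioi (neg_lt_zero.2 hlam) 0).mono'
        (Continuous.aestronglyMeasurable (by fun_prop)) ?_
      filter_upwards [ae_restrict_mem measurableSet_Ioi] with x hx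
      rw [norm_mul, norm_of_nonneg (exp_pos _).le]
      have h := abs_stableCdf_le h1 h2 hx
      rw [pow_zero, one_mul, one_mul] at h
      have : exp (-((x / (γ - 1)) ^ (-(γ - 1)) / 2)) ≤ 1 := by
        rw [exp_le_one_iff]
        have := rpow_pos_of_pos (div_pos hx (by linarith) : 0 < x / (γ - 1)) (-(γ - 1))
        linarith
      have := exp_pos (-lam * x)
      rw [norm_eq_abs]
      nlinarith

lemma laplace_stableDensityDeriv (h1 : 1 < γ) (h2 : γ ≤ 2) {lam : ℝ} (hlam : 0 ≤ lam) :
    ∫ x in Ioi (0 : ℝ), exp (-lam * x) * stableDensityDeriv γ x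
      = lam * exp (-γ * lam ^ idx γ) := by
  rcases hlam.eq_or_lt with rfl | hlam
  · simp only [neg_zero, zero_mul, exp_zero, one_mul]
    rw [integral_Ioi_of_hasDerivAt_of_tendsto' (fun x _ => hasDerivAt_stableDensity h1 h2 x)
      (integrableOn_stableDensityDeriv h1 h2) (tendsto_stableDensity h1 h2),
      stableDensity_of_nonpos le_rfl, sub_zero]
  · rw [← laplace_stableDensity h1 h2 hlam.le]
    refine laplace_deriv hlam (if_pos le_rfl) (continuous_stableDensity h1 h2)
      (fun x _ => hasDerivAt_stableDensity h1 h2 x) (integrableOn_stableDensityDeriv h1 h2)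
      (tendsto_stableDensity h1 h2) ?_
    -- the integral is nonzero, so the integrand is integrable
    by_contra hcon
    have := laplace_stableDensity h1 h2 hlam.le
    rw [integral_undef hcon] at this
    exact (exp_pos _).ne this

end Density

/-! ### Uniqueness -/

/-- A continuous integrable function on `(0, ∞)` whose Laplace transform vanishes at the natural
numbers is zero: polynomials in `exp (-x)` approximate every test function uniformly. -/
lemma eqOn_zero_of_laplace_eq_zero {f : ℝ → ℝ} (hc : ContinuousOn f (Ioi 0))
    (hf : IntegrableOn f (Ioi 0))
    (h : ∀ n : ℕ, ∫ x in Ioi (0 : ℝ), exp (-n * x) * f x = 0) : EqOn f 0 (Ioi 0) := by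
  have hpint : ∀ n : ℕ, IntegrableOn (fun x => exp (-n * x) * f x) (Ioi 0) := by
    intro n
    refine hf.norm.mono' ?_ ?_
    · exact (Continuous.aestronglyMeasurable (by fun_prop)).mul hf.aestronglyMeasurable
    · filter_upwards [ae_restrict_mem measurableSet_Ioi] with x hx
      have hx : 0 < x := hx
      rw [norm_mul, norm_of_nonneg (exp_pos _).le]
      have : exp (-n * x) ≤ 1 := by
        rw [exp_le_one_iff]
        have : (0 : ℝ) ≤ n * x := by positivity
        linarith
      nlinarith [norm_nonneg (f x)]
  have hpoly : ∀ p : Polynomial ℝ, IntegrableOn (fun x => p.eval (exp (-x)) * f x) (Ioi 0) ∧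
      ∫ x in Ioi (0 : ℝ), p.eval (exp (-x)) * f x = 0 := by
    intro p
    have e : (fun x => p.eval (exp (-x)) * f x)
        = fun x => ∑ n ∈ Finset.range (p.natDegree + 1), p.coeff n * (exp (-n * x) * f x) := by
      funext x
      rw [Polynomial.eval_eq_sum_range, Finset.sum_mul]
      refine Finset.sum_congr rfl fun n _ => ?_
      rw [← exp_nat_mul]
      ring_nf
    rw [e]
    refine ⟨integrable_finsetSum _ fun n _ => (hpint n).const_mul _, ?_⟩
    rw [integral_finsetSum _ fun n _ => (hpint n).const_mul _]
    refine Finset.sum_eq_zero fun n _ => ?_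
    rw [integral_const_mul, h n, mul_zero]
  have hae : ∀ᵐ x, x ∈ Ioi (0 : ℝ) → f x = 0 := by
    refine isOpen_Ioi.ae_eq_zero_of_integral_contDiff_smul_eq_zero
      hf.locallyIntegrableOn fun g hg hgc hgs => ?_
    have hg0 : g 0 = 0 := image_eq_zero_of_notMem_tsupport fun h0 =>
      lt_irrefl (0 : ℝ) (mem_Ioi.1 (hgs h0))
    have hset : ∫ x, g x • f x = ∫ x in Ioi (0 : ℝ), g x * f x := by
      refine (setIntegral_eq_integral_of_forall_compl_eq_zero fun x hx => ?_).symm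
      rw [image_eq_zero_of_notMem_tsupport fun h0 => hx (hgs h0), zero_smul]
    rw [hset]
    -- the test function as a continuous function of `exp (-x)` on `[0, 1]`
    have hψ : ContinuousOn (fun u => g (-log u)) (Icc 0 1) := by
      rintro u ⟨hu0, -⟩
      rcases hu0.eq_or_lt with rfl | hu0
      · obtain ⟨R, hR⟩ := hgc.isCompact.isBounded.subset_closedBall 0
        have hzero : ∀ᶠ u in 𝓝[Icc 0 1] (0 : ℝ), g (-log u) = g (-log 0) := by
          have hlt : ∀ᶠ u in 𝓝[Icc 0 1] (0 : ℝ), u < exp (-(|R| + 1)) :=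
            nhdsWithin_le_nhds (Iio_mem_nhds (exp_pos _))
          filter_upwards [hlt, self_mem_nhdsWithin] with u hu huI
          rcases huI.1.eq_or_lt with rfl | hu0
          · rfl
          · rw [log_zero, neg_zero, hg0]
            refine image_eq_zero_of_notMem_tsupport fun hmem => ?_
            have h1 := hR hmem
            rw [Metric.mem_closedBall, dist_zero_right, norm_eq_abs] at h1
            have h2 := (log_lt_iff_lt_exp hu0).2 hu
            have h3 := le_abs_self (-log u)
            have h4 := le_abs_self R
            linarith
        exact continuousWithinAt_const.congr_of_eventuallyEq hzero rfl
      · have : ContinuousAt (fun u => g (-log u)) u :=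
          hg.continuous.continuousAt.comp (continuousAt_log hu0.ne').neg
        exact this.continuousWithinAt
    set J := ∫ x in Ioi (0 : ℝ), ‖f x‖ with hJ
    have hJ0 : 0 ≤ J := integral_nonneg fun x => norm_nonneg _
    have hgint : IntegrableOn (fun x => g x * f x) (Ioi 0) := by
      obtain ⟨C, hC⟩ := hgc.exists_bound_of_continuous hg.continuous
      exact hf.bdd_mul hg.continuous.aestronglyMeasurable (Eventually.of_forall hC)
    have hle : ∀ ε > 0, |∫ x in Ioi (0 : ℝ), g x * f x| ≤ ε * J := by
      intro ε hε
      obtain ⟨p, hp⟩ := exists_polynomial_near_of_continuousOn 0 1 _ hψ ε hε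
      obtain ⟨hpi, hp0⟩ := hpoly p
      have : ∫ x in Ioi (0 : ℝ), g x * f x
          = ∫ x in Ioi (0 : ℝ), (g x * f x - p.eval (exp (-x)) * f x) := by
        rw [integral_sub hgint hpi, hp0, sub_zero]
      rw [this, hJ, ← integral_const_mul, ← norm_eq_abs]
      refine norm_integral_le_of_norm_le (hf.norm.const_mul ε) ?_
      filter_upwards [ae_restrict_mem measurableSet_Ioi] with x hx
      have hx : 0 < x := hx
      have := hp (exp (-x)) ⟨(exp_pos _).le, exp_le_one_iff.2 (by linarith)⟩
      rw [log_exp, neg_neg, abs_sub_comm] at this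
      rw [← sub_mul, norm_mul, norm_eq_abs]
      exact mul_le_mul_of_nonneg_right this.le (norm_nonneg _)
    by_contra hne
    have hpos := abs_pos.2 hne
    have := hle (|∫ x in Ioi (0 : ℝ), g x * f x| / (2 * (J + 1))) (by positivity)
    rw [div_mul_eq_mul_div, le_div_iff₀ (by positivity)] at this
    nlinarith
  refine Measure.eqOn_open_of_ae_eq (μ := volume) ?_ isOpen_Ioi hc continuousOn_const
  exact (ae_restrict_iff' measurableSet_Ioi).2 hae

lemma IsStableDensity.integrableOn {γ : ℝ} {s : ℝ → ℝ} (h : IsStableDensity γ s) {lam : ℝ}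
    (hlam : 0 ≤ lam) : IntegrableOn (fun x => exp (-lam * x) * s x) (Ioi 0) := by
  -- otherwise the integral has the junk value `0`
  by_contra hcon
  have := h.laplace lam hlam
  rw [integral_undef hcon] at this
  exact (exp_pos _).ne this

lemma IsStableDensity.unique {γ : ℝ} {s s' : ℝ → ℝ} (h : IsStableDensity γ s)
    (h' : IsStableDensity γ s') : s' = s := by
  have hi : IntegrableOn s (Ioi 0) := by simpa using h.integrableOn le_rfl
  have hi' : IntegrableOn s' (Ioi 0) := by simpa using h'.integrableOn le_rfl
  have hz := eqOn_zero_of_laplace_eq_zero (h'.continuousOn.sub h.continuousOn) (hi'.sub hi)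
    fun n => by
      simp only [Pi.sub_apply, mul_sub]
      rw [integral_sub (h'.integrableOn n.cast_nonneg) (h.integrableOn n.cast_nonneg),
        h.laplace _ n.cast_nonneg, h'.laplace _ n.cast_nonneg, sub_self]
  funext x
  rcases le_or_gt x 0 with hx | hx
  · rw [h.eq_zero x hx, h'.eq_zero x hx]
  · exact sub_eq_zero.1 (hz hx)

lemma HasExpansionAtZero.unique {γ p : ℝ} (hγ : 1 < γ) {f : ℝ → ℝ} {a a' : ℕ → ℝ} (h0 : a' 0 = a 0)
    (h : HasExpansionAtZero γ p f a) (h' : HasExpansionAtZero γ p f a') : a' = a := by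
  funext n
  induction n using Nat.strong_induction_on with
  | _ n ih =>
    rcases Nat.eq_zero_or_pos n with rfl | hn
    · exact h0
    have hd := (h (n + 1) (by lia)).sub (h' (n + 1) (by lia))
    have hd' : (fun x : ℝ => (a' n - a n) * x ^ ((n : ℝ) * (γ - 1))) =O[𝓝[>] 0]
        fun x : ℝ => x ^ (((n + 1 : ℕ) : ℝ) * (γ - 1)) := by
      refine hd.congr_left fun x => ?_
      have hsum : ∑ k ∈ Finset.Ico 1 n, a' k * x ^ ((k : ℝ) * (γ - 1))
          = ∑ k ∈ Finset.Ico 1 n, a k * x ^ ((k : ℝ) * (γ - 1)) :=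
        Finset.sum_congr rfl fun k hk => by rw [ih k (Finset.mem_Ico.1 hk).2]
      have h1n : 1 ≤ n := hn
      rw [Finset.sum_Ico_succ_top h1n, Finset.sum_Ico_succ_top h1n, hsum]
      ring
    have hr : (fun x : ℝ => x ^ (-((n : ℝ) * (γ - 1)))) =O[𝓝[>] 0]
        fun x : ℝ => x ^ (-((n : ℝ) * (γ - 1))) := Asymptotics.isBigO_refl _ _
    have hconst : (fun _ : ℝ => a' n - a n) =O[𝓝[>] 0] fun x : ℝ => x ^ (γ - 1) := by
      refine (hd'.mul hr).congr' ?_ ?_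
      · filter_upwards [self_mem_nhdsWithin] with x hx
        rw [mul_assoc, ← rpow_add hx, add_neg_cancel, rpow_zero, mul_one]
      · filter_upwards [self_mem_nhdsWithin] with x hx
        rw [← rpow_add hx]
        push_cast
        ring_nf
    have hlim : Tendsto (fun x : ℝ => x ^ (γ - 1)) (𝓝[>] 0) (𝓝 0) := by
      have := (continuousAt_rpow_const 0 (γ - 1) (Or.inr (by linarith))).tendsto
      rw [zero_rpow (by linarith)] at this
      exact this.mono_left nhdsWithin_le_nhds
    have := tendsto_nhds_unique tendsto_const_nhds (hconst.trans_tendsto hlim)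
    linarith

/-! ### Asymptotic expansions -/

/-- `HasAsymp f a`: the function `f` has the asymptotic expansion `∑ a n * y⁻¹ ^ n` as
`y → ∞`. -/
def HasAsymp (f : ℝ → ℝ) (a : ℕ → ℝ) : Prop :=
  ∀ N : ℕ, (fun y => f y - ∑ n ∈ Finset.range N, a n * y⁻¹ ^ n) =O[atTop] fun y : ℝ => y⁻¹ ^ N

/-- The coefficients of `y⁻¹` times a series in `y⁻¹` with coefficients `a`. -/
def shiftSeq (a : ℕ → ℝ) : ℕ → ℝ
  | 0 => 0
  | n + 1 => a n

namespace HasAsymp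

lemma add {f g : ℝ → ℝ} {a b : ℕ → ℝ} (hf : HasAsymp f a) (hg : HasAsymp g b) :
    HasAsymp (fun y => f y + g y) (fun n => a n + b n) := fun N => by
  refine ((hf N).add (hg N)).congr_left fun y => ?_
  simp only [add_mul, Finset.sum_add_distrib]
  ring

lemma const_mul {f : ℝ → ℝ} {a : ℕ → ℝ} (c : ℝ) (hf : HasAsymp f a) :
    HasAsymp (fun y => c * f y) (fun n => c * a n) := fun N => by
  refine ((hf N).const_mul_left c).congr_left fun y => ?_
  simp only [mul_sub, Finset.mul_sum, mul_assoc]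

lemma shift {f : ℝ → ℝ} {a : ℕ → ℝ} (hf : HasAsymp f a) :
    HasAsymp (fun y => y⁻¹ * f y) (shiftSeq a) := by
  intro N
  have hr : (fun y : ℝ => y⁻¹) =O[atTop] fun y : ℝ => y⁻¹ := Asymptotics.isBigO_refl _ _
  cases N with
  | zero =>
    have h1 : (fun y : ℝ => y⁻¹) =O[atTop] fun _ => (1 : ℝ) :=
      tendsto_inv_atTop_zero.isBigO_one ℝ
    simpa using h1.mul (hf 0)
  | succ N =>
    refine (hr.mul (hf N)).congr (fun y => ?_) fun y => by rw [pow_succ']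
    rw [Finset.sum_range_succ', mul_sub, Finset.mul_sum]
    simp only [shiftSeq, zero_mul, add_zero]
    congr 1
    refine Finset.sum_congr rfl fun n _ => ?_
    rw [pow_succ]
    ring

lemma congr {f g : ℝ → ℝ} {a : ℕ → ℝ} (hf : HasAsymp f a) (h : f =ᶠ[atTop] g) : HasAsymp g a :=
  fun N => (hf N).congr' (h.mono fun y hy => by simp only [hy]) EventuallyEq.rfl

/-- An asymptotic expansion at infinity, in the variable `x` with `y = x ^ (-(γ - 1))`. -/
lemma hasExpansionAtZero {γ p : ℝ} (hγ : 1 < γ) {f h : ℝ → ℝ} {a : ℕ → ℝ} (ha : HasAsymp h a)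
    (ha0 : a 0 = 1)
    (hfh : ∀ x, 0 < x → (2 * π * (1 - 1 / γ)) ^ (1 / 2 : ℝ) * x ^ p * exp (1 / x ^ (γ - 1))
      * f ((γ - 1) * x) = h (x ^ (-(γ - 1)))) :
    HasExpansionAtZero γ p f a := by
  intro N hN
  have hγ : 0 < γ - 1 := by linarith
  refine ((ha N).comp_tendsto (tendsto_rpow_neg_nhdsGT_zero (neg_lt_zero.2 hγ))).congr' ?_ ?_
  · filter_upwards [self_mem_nhdsWithin] with x hx
    have hx : 0 < x := hx
    have hpow : ∀ n : ℕ, (x ^ (-(γ - 1)))⁻¹ ^ n = x ^ ((n : ℝ) * (γ - 1)) := by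
      intro n
      rw [← rpow_neg hx.le, neg_neg, ← rpow_natCast, ← rpow_mul hx.le, mul_comm]
    simp only [Function.comp_apply]
    rw [hfh x hx, Finset.range_eq_Ico, Finset.sum_eq_sum_Ico_succ_bot (by lia), ha0]
    simp only [hpow]
    simp
  · filter_upwards [self_mem_nhdsWithin] with x hx
    have hx : 0 < x := hx
    simp only [Function.comp_apply]
    rw [← rpow_neg hx.le, neg_neg, ← rpow_natCast, ← rpow_mul hx.le, mul_comm]

end HasAsymp

/-- The Laplace moments of `phase γ - 1`. -/
noncomputable def excessLaplace (γ : ℝ) (j : ℕ) (y : ℝ) : ℝ :=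
  ∫ φ in Ioo 0 π, (phase γ φ - 1) ^ j * exp (-(y * (phase γ φ - 1)))

lemma hasAsymp_excessLaplace {γ : ℝ} (h1 : 1 < γ) (h2 : γ ≤ 2) :
    ∃ b : ℕ → ℝ, b 0 = √(2 / idx γ) ∧ ∀ j : ℕ,
      HasAsymp (fun y => y ^ j * √y * excessLaplace γ j y)
        (fun k => b k * (Real.Gamma ((k + j : ℕ) + 1 / 2) / 2)) := by
  obtain ⟨b, hb0, hb⟩ := phase_moment_expansion h1 h2
  refine ⟨b, hb0, fun j N => ?_⟩
  -- one more term than needed, since the error estimate loses a factor `√y`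
  obtain ⟨M, hM0, hM⟩ := hb j (N + 1)
  set β := b N * (Real.Gamma ((N + j : ℕ) + 1 / 2) / 2) with hβ
  refine Asymptotics.IsBigO.of_bound (2 * M + |β|) ?_
  filter_upwards [eventually_ge_atTop 1] with y hy
  have hy0 : 0 < y := by linarith
  have hs : 0 < √y := Real.sqrt_pos.2 hy0
  have hsy : √y ≤ y := by
    rw [Real.sqrt_le_left hy0.le]
    nlinarith
  have h := hM y hy0
  have hscale : y ^ j * √y * excessLaplace γ j y
      - ∑ k ∈ Finset.range (N + 1), b k * (Real.Gamma ((k + j : ℕ) + 1 / 2) / 2) * y⁻¹ ^ k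
      = y ^ j * √y * (excessLaplace γ j y - ∑ k ∈ Finset.range (N + 1),
        b k * (Real.Gamma ((k + j : ℕ) + 1 / 2) / 2 * y⁻¹ ^ (k + j) / √y)) := by
    rw [mul_sub, Finset.mul_sum]
    congr 1
    refine Finset.sum_congr rfl fun k _ => ?_
    rw [pow_add, inv_pow, inv_pow]
    field_simp
  rw [Finset.sum_range_succ, ← hβ] at hscale
  have hN : 0 < y⁻¹ ^ N := by positivity
  have hbound : |y ^ j * √y * (excessLaplace γ j y - ∑ k ∈ Finset.range (N + 1),
        b k * (Real.Gamma ((k + j : ℕ) + 1 / 2) / 2 * y⁻¹ ^ (k + j) / √y))| ≤ 2 * M * y⁻¹ ^ N := by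
    rw [abs_mul, abs_of_pos (by positivity)]
    calc _ ≤ y ^ j * √y * (M * (y⁻¹ ^ (N + 1 + j) * (1 + 1 / √y))) :=
          mul_le_mul_of_nonneg_left h (by positivity)
      _ = M * (y⁻¹ ^ N * ((√y + 1) / y)) := by
          rw [pow_add, pow_succ, inv_pow y j]
          field_simp
      _ ≤ M * (y⁻¹ ^ N * 2) := by
          have : (√y + 1) / y ≤ 2 := by
            rw [div_le_iff₀ hy0]
            linarith
          gcongr
      _ = _ := by ring
  rw [norm_eq_abs, norm_of_nonneg hN.le]
  calc |y ^ j * √y * excessLaplace γ j y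
        - ∑ k ∈ Finset.range N, b k * (Real.Gamma ((k + j : ℕ) + 1 / 2) / 2) * y⁻¹ ^ k|
      = |y ^ j * √y * (excessLaplace γ j y - ∑ k ∈ Finset.range (N + 1),
          b k * (Real.Gamma ((k + j : ℕ) + 1 / 2) / 2 * y⁻¹ ^ (k + j) / √y)) + β * y⁻¹ ^ N| := by
        rw [← hscale, ← sub_sub, sub_add_cancel]
    _ ≤ 2 * M * y⁻¹ ^ N + |β * y⁻¹ ^ N| := (abs_add_le _ _).trans (by gcongr)
    _ = (2 * M + |β|) * y⁻¹ ^ N := by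
        rw [abs_mul, abs_of_pos hN]
        ring

section Final

variable {γ : ℝ}

lemma exp_mul_phaseLaplace_one (h1 : 1 < γ) (h2 : γ ≤ 2) {y : ℝ} (hy : 0 < y) :
    exp y * phaseLaplace γ 1 y = excessLaplace γ 0 y + excessLaplace γ 1 y := by
  rw [phaseLaplace, excessLaplace, excessLaplace, ← integral_const_mul,
    ← integral_add (integrableOn_phase_moment h1 h2 0 hy) (integrableOn_phase_moment h1 h2 1 hy)]
  refine integral_congr_ae (Eventually.of_forall fun φ => ?_)
  have e : exp (-(y * (phase γ φ - 1))) = exp y * exp (-(y * phase γ φ)) := by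
    rw [← exp_add]; ring_nf
  simp only [e]
  ring

lemma exp_mul_phaseLaplace_two (h1 : 1 < γ) (h2 : γ ≤ 2) {y : ℝ} (hy : 0 < y) :
    exp y * phaseLaplace γ 2 y
      = excessLaplace γ 0 y + 2 * excessLaplace γ 1 y + excessLaplace γ 2 y := by
  have i0 := integrableOn_phase_moment h1 h2 0 hy
  have i1 := (integrableOn_phase_moment h1 h2 1 hy).const_mul 2
  have i2 := integrableOn_phase_moment h1 h2 2 hy
  have i01 : IntegrableOn (fun φ => (phase γ φ - 1) ^ 0 * exp (-(y * (phase γ φ - 1))) +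
      2 * ((phase γ φ - 1) ^ 1 * exp (-(y * (phase γ φ - 1))))) (Ioo 0 π) := i0.add i1
  rw [phaseLaplace, excessLaplace, excessLaplace, excessLaplace, ← integral_const_mul,
    ← integral_const_mul, ← integral_add i0 i1, ← integral_add i01 i2]
  refine integral_congr_ae (Eventually.of_forall fun φ => ?_)
  have e : exp (-(y * (phase γ φ - 1))) = exp y * exp (-(y * phase γ φ)) := by
    rw [← exp_add]; ring_nf
  simp only [e]
  ring

lemma isStableDensity_stableDensity (h1 : 1 < γ) (h2 : γ ≤ 2) :
    IsStableDensity γ (stableDensity γ) where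
  eq_zero _ hx := if_pos hx
  pos _ hx := stableDensity_pos h1 h2 hx
  continuousOn := (continuous_stableDensity h1 h2).continuousOn
  laplace _ hlam := laplace_stableDensity h1 h2 hlam

/-- The expansions of the density and of its derivative. Both are linear
combinations of the moments of `phase γ - 1`, whose coefficients are multiples of those of the
zeroth moment, `A`, by the functional equation of `Γ`; the recursion of `derivCoeff` is then an
identity in `A`. -/
lemma exists_expansion_stableDensity (h1 : 1 < γ) (h2 : γ ≤ 2) :
    ∃ S : ℕ → ℝ, S 0 = 1 ∧ HasExpansionAtZero γ ((γ + 1) / 2) (stableDensity γ) S ∧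
      HasExpansionAtZero γ ((3 * γ + 1) / 2) (stableDensityDeriv γ) (derivCoeff γ S) := by
  obtain ⟨b, hb0, hb⟩ := hasAsymp_excessLaplace h1 h2
  have hγ : 0 < γ - 1 := by linarith
  have ha := idx_pos h1
  set κ := (2 * π * (1 - 1 / γ)) ^ (1 / 2 : ℝ) with hκ
  have hκ' : κ = √(2 * π * idx γ) := by
    rw [hκ, sqrt_eq_rpow, idx]
    congr 2
    field_simp
  -- the coefficients of the normalised zeroth moment
  set A : ℕ → ℝ := fun k => κ / π * (b k * (Real.Gamma (k + 1 / 2) / 2)) with hA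
  have hA0 : A 0 = 1 := by
    simp only [hA]
    rw [hb0, Nat.cast_zero, zero_add, Real.Gamma_one_half_eq, hκ']
    have e : √(2 * π * idx γ) * √(2 / idx γ) * √π = 2 * π := by
      rw [← Real.sqrt_mul (by positivity), ← Real.sqrt_mul (by positivity),
        Real.sqrt_eq_iff_mul_self_eq (by positivity) (by positivity)]
      field_simp
    have hπ := pi_pos
    field_simp
    linarith
  have hG : ∀ z : ℝ, 0 < z → Real.Gamma (z + 1) = z * Real.Gamma z := fun z hz =>
    Real.Gamma_add_one hz.ne'
  have e0 : HasAsymp (fun y => κ / π * (√y * excessLaplace γ 0 y)) A := by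
    have := (hb 0).const_mul (κ / π)
    simpa [hA] using this
  have e1 : HasAsymp (fun y => κ / π * (y ^ 1 * √y * excessLaplace γ 1 y))
      (fun k => (k + 1 / 2) * A k) := by
    have := (hb 1).const_mul (κ / π)
    convert this using 2 with k
    have hg := hG (k + 1 / 2) (by positivity)
    rw [show ((k + 1 : ℕ) : ℝ) + 1 / 2 = (k + 1 / 2) + 1 by push_cast; ring, hg]
    simp only [hA]
    ring
  have e2 : HasAsymp (fun y => κ / π * (y ^ 2 * √y * excessLaplace γ 2 y))
      (fun k => (k + 3 / 2) * (k + 1 / 2) * A k) := by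
    have := (hb 2).const_mul (κ / π)
    convert this using 2 with k
    have hg := hG (k + 1 / 2) (by positivity)
    have hg' := hG (k + 1 / 2 + 1) (by positivity)
    rw [show ((k + 2 : ℕ) : ℝ) + 1 / 2 = (k + 1 / 2 + 1) + 1 by push_cast; ring, hg', hg]
    simp only [hA]
    ring
  set S : ℕ → ℝ := fun n => A n + shiftSeq (fun k => (k + 1 / 2) * A k) n with hS
  have hS0 : S 0 = 1 := by simp [hS, hA0, shiftSeq]
  have eS : HasAsymp (fun y => κ / π * (√y * (exp y * phaseLaplace γ 1 y))) S := by
    refine (e0.add e1.shift).congr ?_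
    filter_upwards [eventually_gt_atTop 0] with y hy
    rw [exp_mul_phaseLaplace_one h1 h2 hy]
    field_simp
  have eT : HasAsymp (fun y => κ / π * (√y * (exp y * phaseLaplace γ 2 y))
      + -(γ / (γ - 1)) * (y⁻¹ * (κ / π * (√y * (exp y * phaseLaplace γ 1 y)))))
      (derivCoeff γ S) := by
    have h := ((e0.add (e1.shift.const_mul 2)).add e2.shift.shift).add
      (eS.shift.const_mul (-(γ / (γ - 1))))
    have hcoeff : (fun n => A n + 2 * shiftSeq (fun k => (k + 1 / 2) * A k) n
        + shiftSeq (shiftSeq fun k => (k + 3 / 2) * (k + 1 / 2) * A k) n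
        + -(γ / (γ - 1)) * shiftSeq S n) = derivCoeff γ S := by
      have hq : γ / (γ - 1) = 1 + 1 / (γ - 1) := by field_simp; ring
      funext n
      rw [hq]
      rcases n with _ | _ | n
      · simp [derivCoeff, shiftSeq, hA0]
      · simp only [derivCoeff, shiftSeq, hS]
        push_cast
        ring
      · simp only [derivCoeff, shiftSeq, hS]
        push_cast
        ring
    rw [← hcoeff]
    refine h.congr ?_
    filter_upwards [eventually_gt_atTop 0] with y hy
    rw [exp_mul_phaseLaplace_two h1 h2 hy]
    field_simp
  have hsqrt : ∀ x : ℝ, 0 < x → √(x ^ (-(γ - 1))) = x ^ (-(γ - 1) / 2) := by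
    intro x hx
    rw [sqrt_eq_rpow, ← rpow_mul hx.le]
    ring_nf
  refine ⟨S, hS0, eS.hasExpansionAtZero h1 hS0 fun x hx => ?_,
    eT.hasExpansionAtZero h1 rfl fun x hx => ?_⟩
  · have hx' : 0 < (γ - 1) * x := by positivity
    rw [stableDensity, if_neg hx'.not_ge, mul_div_cancel_left₀ _ hγ.ne', hsqrt x hx,
      one_div (x ^ (γ - 1)), ← rpow_neg hx.le]
    have e : x ^ ((γ + 1) / 2) * x ^ (-γ) = x ^ (-(γ - 1) / 2) := by
      rw [← rpow_add hx]; ring_nf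
    linear_combination (κ * exp (x ^ (-(γ - 1))) * π⁻¹ * phaseLaplace γ 1 (x ^ (-(γ - 1)))) * e
  · have hx' : 0 < (γ - 1) * x := by positivity
    rw [stableDensityDeriv, if_neg hx'.not_ge, mul_div_cancel_left₀ _ hγ.ne', hsqrt x hx,
      one_div (x ^ (γ - 1)), ← rpow_neg hx.le, ← rpow_neg hx.le, neg_neg]
    have e : x ^ ((3 * γ + 1) / 2) * (x ^ (-γ) * x ^ (-γ)) = x ^ (-(γ - 1) / 2) := by
      rw [← rpow_add hx, ← rpow_add hx]; ring_nf
    have e' : x ^ ((3 * γ + 1) / 2) * x ^ (-γ - 1) = x ^ (γ - 1) * x ^ (-(γ - 1) / 2) := by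
      rw [← rpow_add hx, ← rpow_add hx]; ring_nf
    linear_combination (κ * exp (x ^ (-(γ - 1))) * π⁻¹ * phaseLaplace γ 2 (x ^ (-(γ - 1)))) * e
      - (κ * exp (x ^ (-(γ - 1))) * π⁻¹ * (γ / (γ - 1)) * phaseLaplace γ 1 (x ^ (-(γ - 1)))) * e'

end Final

end StableLaw

theorem proposition1p6 (γ : ℝ) (hγ1 : 1 < γ) (hγ2 : γ ≤ 2) :
    ∃ s : ℝ → ℝ,
      -- `s` is the stable density, and it is the only one
      StableLaw.IsStableDensity γ s ∧
      (∀ s' : ℝ → ℝ, StableLaw.IsStableDensity γ s' → s' = s) ∧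
      -- regularity, integrability and Laplace transform of the derivative
      ContDiffOn ℝ 1 s (Set.Ici 0) ∧
      MeasureTheory.IntegrableOn (deriv s) (Set.Ioi 0) ∧
      (∀ lam : ℝ, 0 ≤ lam →
        ∫ x in Set.Ioi (0 : ℝ), Real.exp (-lam * x) * deriv s x
          = lam * Real.exp (-γ * lam ^ ((γ - 1) / γ))) ∧
      -- the coefficients `S` of the expansion of `s`, and the expansion of the derivative
      ∃ S : ℕ → ℝ,
        (S 0 = 1 ∧ StableLaw.HasExpansionAtZero γ ((γ + 1) / 2) s S) ∧
        (∀ S' : ℕ → ℝ,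
          S' 0 = 1 ∧ StableLaw.HasExpansionAtZero γ ((γ + 1) / 2) s S' → S' = S) ∧
        StableLaw.HasExpansionAtZero γ ((3 * γ + 1) / 2) (deriv s) (StableLaw.derivCoeff γ S) := by
  have hs := StableLaw.isStableDensity_stableDensity hγ1 hγ2
  obtain ⟨S, hS0, hS, hT⟩ := StableLaw.exists_expansion_stableDensity hγ1 hγ2
  refine ⟨StableLaw.stableDensity γ, hs, fun s' hs' => hs.unique hs',
    (StableLaw.contDiff_stableDensity hγ1 hγ2).contDiffOn, ?_, ?_, S, ⟨hS0, hS⟩, ?_, ?_⟩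
  · rw [StableLaw.deriv_stableDensity hγ1 hγ2]
    exact StableLaw.integrableOn_stableDensityDeriv hγ1 hγ2
  · intro lam hlam
    rw [StableLaw.deriv_stableDensity hγ1 hγ2]
    exact StableLaw.laplace_stableDensityDeriv hγ1 hγ2 hlam
  · rintro S' ⟨hS'0, hS'⟩
    exact hS.unique hγ1 (by rw [hS'0, hS0]) hS'
  · rwa [StableLaw.deriv_stableDensity hγ1 hγ2]
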